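/- **Theorem 6.1.** Let $n\ge 4$, let $e_1,\dots,e_n$ be the standard basis of Euclidean space $\mathbb R^n$, and let $\Phi=\{\pm e_i\pm e_j \mid 1\le i<j\le n\}$ be the root system of type $D_n$. Let $D_n=\mathbb Z\Phi$ be its root lattice and let $\mathcal W=\mathcal W(D_n)$ be its Weyl group, that is, the group generated by the orthogonal reflections in the hyperplanes $\alpha^\perp$, $\alpha\in\Phi$. The group $\mathcal W$ acts on the group rings of $D_n$ and of $\bigoplus_i\mathbb Z\tfrac12e_i\supseteq D_n$ by $w(\mathbf x^v)=\mathbf x^{w(v)}$; let $\mathbb Z[D_n]^{\mathcal W}$ be the algebra of invariants in $\mathbb Z[D_n]$. Put $x_i=\mathbf x^{e_i}$, $y_i=\mathbf x^{\frac12 e_i}$, $\mathbb Z_+=\{0,1,2,\dots\}$, $$\sigma_i=\sum_{\substack{I\subseteq\{1,\dots,n\}\\ |I|=i}}\ \prod_{j\in I}(x_j+x_j^{-1}),\qquad \tau_\pm=\sum_{\substack{(d_1,\dots,d_n)\in\{\pm1\}^n\\ \prod_i d_i=\pm1}} y_1^{d_1}\cdots y_n^{d_n}.$$ Then $\tau_+$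 and $\tau_-$ are the $\mathcal W$-orbit sums $\sum_{u\in \mathcal W v}\mathbf x^u$ of the half-spin weights $v=\tfrac12(e_1+\dots+e_{n-1}+e_n)$ and $v=\tfrac12(e_1+\dots+e_{n-1}-e_n)$ respectively, and the following hold. (a) *Monoid algebra structure.* Let $$M_n=\Big\{(l_i)\in\mathbb Z_+^n \;\Big|\; l_{n-1}+l_n\in2\mathbb Z \text{ and } \tfrac{l_{n-1}+l_n}{2}\,n+l_{n-1}+\sum_{i\le n-2,\ i\text{ odd}}l_i\in2\mathbb Z\Big\}.$$ There is an isomorphism of rings $\mathbb Z[M_n]\to\mathbb Z[D_n]^{\mathcal W}$ that sends each $(l_1,\dots,l_n)\in M_n$ to $\sigma_1^{l_1}\cdots\sigma_{n-2}^{l_{n-2}}\tau_-^{l_{n-1}}\tau_+^{l_n}$. Moreover $M_n\cong\mathbb Z_+^{\lfloor (n-2)/2\rfloor}\oplus W$ as monoids, where $$W=\Big\{(k_i)\in\mathbb Z_+^{\lceil (n+2)/2\rceil}\;\Big|\; k_1+k_2\in2\mathbb Z\text{ and }\tfrac{k_1+k_2}{2}\,n+\sum_{i\ge2}k_i\in2\mathbb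 Z\Big\}.$$ Call a nonzero element $m$ of $M_n$ indecomposable if $m=a+b$ with $a,b\in M_n$ implies $a=0$ or $b=0$; the Hilbert basis of $M_n$ is the set of its indecomposable elements. Elements $\pi_1,\dots,\pi_n$ of $\mathbb Z[D_n]^{\mathcal W}$ are called primary invariants if they are algebraically independent over $\mathbb Z$ and $\mathbb Z[D_n]^{\mathcal W}$ is a finite module over $\mathbb Z[\pi_1,\dots,\pi_n]$. (b) *Fundamental invariants for $n$ even.* For $1\le i\le n-2$ put $\pi_i=\sigma_i^2$ if $i$ is odd and $\pi_i=\sigma_i$ if $i$ is even, and put $\pi_{n-1}=\tau_-^2$, $\pi_n=\tau_+^2$. Put $\gamma_i=\sigma_i\tau_-\tau_+$ for odd $i$ with $1\le i\le n-2$, and $\gamma_{i,j}=\sigma_i\sigma_j$ for $1\le i<j\le n-2$ both odd. The set of all these elements has exactly $\frac18(n^2+6n)$ elements, it is the image of the Hilbert basis of $M_n$ under the map in (a), and it generates the ring $\mathbb Z[D_n]^{\mathcal W}$; the elements $\pi_1,\dots,\pi_n$ are primary invariants. (c) *Fundamental invariants for $n$ odd.* Let $\pi_i$ for $1\le i\le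 n-2$ be as in (b), and put $\pi_{n-1}=\tau_-^4$, $\pi_n=\tau_+^4$. Put $\gamma_{i,j}=\sigma_i\sigma_j$ for $1\le i<j\le n-2$ both odd, $\gamma_{n-1,n}=\tau_-\tau_+$, and $\gamma_{i,n-1}=\sigma_i\tau_-^2$, $\gamma_{i,n}=\sigma_i\tau_+^2$ for odd $i$ with $1\le i\le n-2$. The set of all these elements has exactly $\frac18(n^2+12n+3)$ elements, it is the image of the Hilbert basis of $M_n$ under the map in (a), and it generates the ring $\mathbb Z[D_n]^{\mathcal W}$; the elements $\pi_1,\dots,\pi_n$ are primary invariants. -/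

import Mathlib

noncomputable section

namespace RootInv

/-- Euclidean space `ℝⁿ`. -/
abbrev E (n : ℕ) : Type := EuclideanSpace ℝ (Fin n)

/-- The standard basis vector `e_i` of `ℝⁿ`. -/
def e {n : ℕ} (i : Fin n) : E n := EuclideanSpace.single i 1

/-- The group ring `ℤ[E]` of the additive group of `E = ℝⁿ`. For every lattice `L ⊂ E`, the group ring
`ℤ[L]` is the subring of all elements supported in `L`; it is used here only as a common home for the
group rings of the root lattice and of `⊕ ℤ (e_i / 2)`. -/
abbrev GroupRing (n : ℕ) : Type := AddMonoidAlgebra ℤ (E n)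

/-- The monomial `x^v`, for `v ∈ E`. -/
def X {n : ℕ} (v : E n) : GroupRing n := AddMonoidAlgebra.single v 1

/-! ### Root lattice, Weyl group, multiplicative invariants -/

/-- The root lattice `ℤΦ` of a set of roots `Φ`. -/
def rootLattice {n : ℕ} (Φ : Set (E n)) : AddSubgroup (E n) := AddSubgroup.closure Φ

/-- The Weyl group of `Φ`: the group generated by the orthogonal reflections in the hyperplanes `α^⊥`,
`α ∈ Φ`. -/
def weylGroup {n : ℕ} (Φ : Set (E n)) : Subgroup (E n ≃ₗᵢ[ℝ] E n) :=
  Subgroup.closure {s | ∃ α ∈ Φ, s = (Submodule.span ℝ {α})ᗮ.reflection}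

/-- The group ring `ℤ[L]` of a subgroup `L` of `E`, inside `ℤ[E]`. -/
def latticeRing {n : ℕ} (L : AddSubgroup (E n)) : Subalgebra ℤ (GroupRing n) :=
  (AddMonoidAlgebra.mapDomainAlgHom ℤ ℤ L.subtype).range

/-- The action of a linear isometry `w` on `ℤ[E]`: `x^v ↦ x^(w v)`. -/
def act {n : ℕ} (w : E n ≃ₗᵢ[ℝ] E n) : GroupRing n →ₐ[ℤ] GroupRing n :=
  AddMonoidAlgebra.mapDomainAlgHom ℤ ℤ (w.toLinearEquiv.toAddEquiv : E n →+ E n)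

/-- The multiplicative invariant algebra `ℤ[L]^W` of the root lattice `L = ℤΦ` under the Weyl group
`W` of `Φ`. -/
def invariants {n : ℕ} (Φ : Set (E n)) : Subalgebra ℤ (GroupRing n) :=
  latticeRing (rootLattice Φ) ⊓ ⨅ w ∈ weylGroup Φ, AlgHom.equalizer (act w) (AlgHom.id ℤ (GroupRing n))

/-- The orbit sum of `v` under the Weyl group of `Φ`: the sum of the `x^u`, `u` in the orbit of `v`
(a finite set when `Φ` is a root system). -/
def orbitSum {n : ℕ} (Φ : Set (E n)) (v : E n) : GroupRing n :=
  ∑ᶠ u ∈ {u : E n | ∃ w ∈ weylGroup Φ, w v = u}, X u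

/-- The root system of type `D_n`: all `± e_i ± e_j` with `i < j`. -/
def rootsD (n : ℕ) : Set (E n) :=
  {v | ∃ i j : Fin n, i < j ∧ ∃ s t : ℤˣ, v = (s : ℤ) • e i + (t : ℤ) • e j}

/-! ### The invariants `σ_i`, `τ_±` -/

/-- `σ_i`: the `i`-th elementary symmetric function in `x_1 + x_1⁻¹, …, x_n + x_n⁻¹`, with
`x_j = x^(e_j)`. -/
def sigma (n i : ℕ) : GroupRing n :=
  ∑ I ∈ Finset.powersetCard i (Finset.univ : Finset (Fin n)), ∏ j ∈ I, (X (e j) + X (-e j))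

/-- `τ_s` for a sign `s`: the sum of all `y_1^(d_1) ⋯ y_n^(d_n)` with `d_i = ± 1` and `∏ d_i = s`, where
`y_i = x^(e_i / 2)`. -/
def tau (n : ℕ) (s : ℤˣ) : GroupRing n :=
  ∑ d : Fin n → ℤˣ with ∏ i, d i = s, ∏ i, X ((((d i : ℤ) : ℝ) / 2) • e i)

/-- The half-spin weight `(e_1 + ⋯ + e_n) / 2`. -/
def spinPlus (n : ℕ) : E n := ∑ i : Fin n, (1 / 2 : ℝ) • e i

/-- The half-spin weight `(e_1 + ⋯ + e_(n-1) - e_n) / 2`. -/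
def spinMinus (n : ℕ) : E n :=
  ∑ i : Fin n, (if (i : ℕ) + 1 = n then (-1 / 2 : ℝ) else 1 / 2) • e i

/-! ### The monoids -/

/-- The `i`-th entry `l_i` of a tuple `(l_1, …, l_N)`, counted from `1` (and `0` if there is no such
entry). -/
def entry {N : ℕ} (l : Fin N → ℕ) (i : ℕ) : ℕ := if h : 1 ≤ i ∧ i ≤ N then l ⟨i - 1, by omega⟩ else 0

theorem entry_add {N : ℕ} (l m : Fin N → ℕ) (i : ℕ) : entry (l + m) i = entry l i + entry m i := by
  unfold entry; split_ifs <;> simp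

theorem entry_zero {N : ℕ} (i : ℕ) : entry (0 : Fin N → ℕ) i = 0 := by
  unfold entry; split_ifs <;> simp

theorem even_half_add {a b c d n s t : ℕ} (h₁ : Even a)
    (k₁ : Even (a / 2 * n + c + s)) (k₂ : Even (b / 2 * n + d + t)) :
    Even ((a + b) / 2 * n + (c + d) + (s + t)) := by
  have h : (a + b) / 2 = a / 2 + b / 2 := Nat.add_div_of_dvd_right h₁.two_dvd
  have k := k₁.add k₂
  have h' : (a / 2 + b / 2) * n + (c + d) + (s + t)
      = (a / 2 * n + c + s) + (b / 2 * n + d + t) := by ring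
  rw [h, h']
  exact k

/-- The monoid `M_n` of all `(l_1, …, l_n) ∈ ℕⁿ` such that `l_(n-1) + l_n` is even and
`(l_(n-1) + l_n) / 2 * n + l_(n-1) + ∑ l_i` (sum over odd `i ≤ n - 2`) is even. -/
def M (n : ℕ) : AddSubmonoid (Fin n → ℕ) where
  carrier := {l | Even (entry l (n - 1) + entry l n) ∧
    Even ((entry l (n - 1) + entry l n) / 2 * n + entry l (n - 1)
      + ∑ i ∈ Finset.Icc 1 (n - 2) with Odd i, entry l i)}
  zero_mem' := by simp [entry_zero]
  add_mem' := by
    rintro a b ⟨h₁, k₁⟩ ⟨h₂, k₂⟩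
    simp only [Set.mem_ofPred_eq, entry_add, Finset.sum_add_distrib]
    have h : entry a (n - 1) + entry b (n - 1) + (entry a n + entry b n)
        = (entry a (n - 1) + entry a n) + (entry b (n - 1) + entry b n) := by ring
    rw [h]
    exact ⟨h₁.add h₂, even_half_add h₁ k₁ k₂⟩

/-- The monoid `W_n` of all `(k_1, …, k_N) ∈ ℕ^N`, `N = ⌈(n + 2) / 2⌉ = ⌊(n + 3) / 2⌋`, such that
`k_1 + k_2` is even and `(k_1 + k_2) / 2 * n + ∑_{i ≥ 2} k_i` is even. -/
def W (n : ℕ) : AddSubmonoid (Fin ((n + 3) / 2) → ℕ) where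
  carrier := {k | Even (entry k 1 + entry k 2) ∧
    Even ((entry k 1 + entry k 2) / 2 * n + ∑ i ∈ Finset.Icc 2 ((n + 3) / 2), entry k i)}
  zero_mem' := by simp [entry_zero]
  add_mem' := by
    rintro a b ⟨h₁, k₁⟩ ⟨h₂, k₂⟩
    simp only [Set.mem_ofPred_eq, entry_add, Finset.sum_add_distrib]
    have h : entry a 1 + entry b 1 + (entry a 2 + entry b 2)
        = (entry a 1 + entry a 2) + (entry b 1 + entry b 2) := by ring
    rw [h]
    have k := even_half_add (n := n) (c := 0) (d := 0) h₁ k₁ k₂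
    exact ⟨h₁.add h₂, k⟩

/-- The Hilbert basis of a submonoid `S` of `ℕ^N`: its indecomposable elements. -/
def hilbertBasis {N : ℕ} (S : AddSubmonoid (Fin N → ℕ)) : Set (Fin N → ℕ) :=
  {m | m ∈ S ∧ m ≠ 0 ∧ ∀ a ∈ S, ∀ b ∈ S, m = a + b → a = 0 ∨ b = 0}

/-- `σ_1^(l_1) ⋯ σ_(n-2)^(l_(n-2)) τ_-^(l_(n-1)) τ_+^(l_n)`. -/
def mono {n : ℕ} (l : Fin n → ℕ) : GroupRing n :=
  (∏ i ∈ Finset.Icc 1 (n - 2), sigma n i ^ entry l i) * tau n (-1) ^ entry l (n - 1)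
    * tau n 1 ^ entry l n

/-! ### Fundamental and primary invariants -/

/-- `π_i` for `1 ≤ i ≤ n` (`n` even). -/
def primEven (n i : ℕ) : GroupRing n :=
  if i ≤ n - 2 then (if Odd i then sigma n i ^ 2 else sigma n i)
  else if i = n - 1 then tau n (-1) ^ 2 else tau n 1 ^ 2

/-- `π_i` for `1 ≤ i ≤ n` (`n` odd). -/
def primOdd (n i : ℕ) : GroupRing n :=
  if i ≤ n - 2 then (if Odd i then sigma n i ^ 2 else sigma n i)
  else if i = n - 1 then tau n (-1) ^ 4 else tau n 1 ^ 4

/-- The set of all `π_i`, `γ_i`, `γ_{i,j}` for `n` even. -/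
def fundEven (n : ℕ) : Set (GroupRing n) :=
  {f | ∃ i, 1 ≤ i ∧ i ≤ n ∧ f = primEven n i}
  ∪ {f | ∃ i, 1 ≤ i ∧ i ≤ n - 2 ∧ Odd i ∧ f = sigma n i * tau n (-1) * tau n 1}
  ∪ {f | ∃ i j, 1 ≤ i ∧ i < j ∧ j ≤ n - 2 ∧ Odd i ∧ Odd j ∧ f = sigma n i * sigma n j}

/-- The set of all `π_i`, `γ_{i,j}`, `γ_{n-1,n}`, `γ_{i,n-1}`, `γ_{i,n}` for `n` odd. -/
def fundOdd (n : ℕ) : Set (GroupRing n) :=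
  {f | ∃ i, 1 ≤ i ∧ i ≤ n ∧ f = primOdd n i}
  ∪ {f | ∃ i j, 1 ≤ i ∧ i < j ∧ j ≤ n - 2 ∧ Odd i ∧ Odd j ∧ f = sigma n i * sigma n j}
  ∪ {tau n (-1) * tau n 1}
  ∪ {f | ∃ i, 1 ≤ i ∧ i ≤ n - 2 ∧ Odd i ∧ f = sigma n i * tau n (-1) ^ 2}
  ∪ {f | ∃ i, 1 ≤ i ∧ i ≤ n - 2 ∧ Odd i ∧ f = sigma n i * tau n 1 ^ 2}

/-- `π_1, …, π_n` are primary invariants of the algebra `S`: they lie in `S`, are algebraically independent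
over `ℤ`, and `S` is a finite module over `ℤ[π_1, …, π_n]`. -/
def IsPrimary {R : Type} [CommRing R] (S : Subalgebra ℤ R) {n : ℕ} (p : Fin n → R) : Prop :=
  AlgebraicIndependent ℤ p ∧
    ∃ h : ∀ i, p i ∈ S,
      (MvPolynomial.aeval (fun i => (⟨p i, h i⟩ : S)) : MvPolynomial (Fin n) ℤ →ₐ[ℤ] S).Finite

end RootInv

end

namespace RootInv

variable {n : ℕ}

/-! ### Monomials and leading exponents -/

/-! The argument is a triangularity argument for the lexicographic order on exponents. The leading
exponents of `σ_1, …, σ_(n-2), τ_-, τ_+` are the vectors `ω_i = e_1 + ⋯ + e_i` and the two half-spin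
weights, that is, the fundamental weights of `D_n`, each with coefficient one (`isLead_sigma`,
`isLead_tau`). So `mono l` has leading exponent `wt l = ∑ l_i ω_i`. Distinct `l` give distinct `wt
l`, whence the monomials are linearly independent (`linearIndependent_mono`).

All exponents of `mono l` are congruent modulo the root lattice, and `wt l` lies in that lattice
exactly when `l ∈ M n` (`wt_mem_iff`): the two parity conditions say that the coordinates are
integers and that their sum is even. Conversely, the leading exponent of an invariant cannot be
raised by a reflection, so it is dominant and equals some `wt l` with `l ∈ M n`
(`exists_leading_wt`). Subtracting a multiple of `mono l` lowers the leading exponent, and this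
terminates (`mem_span_mono`). Hence the `mono l`, `l ∈ M n`, form a basis of the invariants, which
is the monoid algebra isomorphism.

The rest is combinatorics of `M n`. Membership involves only the sum of the entries at odd positions
`≤ n - 2` and the last two entries, so indecomposability becomes a parity question about four
numbers (`mem_hilbertBasis_iff`, `indecomposable_iff_even`, `indecomposable_iff_odd`). The Hilbert
basis is a disjoint union of explicit fibers, which are counted directly. Indecomposables generate,
by induction on the sum of the entries.

The primary invariants are powers of the basic `σ_i` and `τ_±` with exponents dividing 4. Their
independence is linear independence of monomials. The fourth power of any monomial is a monomial in
them, so the invariants are integral and finitely generated over them, hence a finite module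
(`isPrimary_mono`). -/

theorem X_zero : X (0 : E n) = 1 := rfl

theorem X_add (u v : E n) : X (u + v) = X u * X v := by
  simp [X, AddMonoidAlgebra.single_mul_single]

theorem prod_X {ι : Type*} (s : Finset ι) (v : ι → E n) :
    ∏ i ∈ s, X (v i) = X (∑ i ∈ s, v i) := by
  classical
  induction s using Finset.induction_on with
  | empty => simp [X_zero]
  | insert a s ha ih => rw [Finset.prod_insert ha, Finset.sum_insert ha, ih, X_add]

open Classical in
theorem coeff_X (u v : E n) : (X u).coeff v = if u = v then 1 else 0 := by
  simp [X, Finsupp.single_apply]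

theorem exists_of_coeff_mul_ne_zero {f g : GroupRing n} {u : E n} (h : (f * g).coeff u ≠ 0) :
    ∃ a b, f.coeff a ≠ 0 ∧ g.coeff b ≠ 0 ∧ a + b = u := by
  classical
  have h1 := AddMonoidAlgebra.support_coeff_mul_subset f g (Finsupp.mem_support_iff.2 h)
  obtain ⟨a, ha, b, hb, hab⟩ := Finset.mem_add.1 h1
  exact ⟨a, b, Finsupp.mem_support_iff.1 ha, Finsupp.mem_support_iff.1 hb, hab⟩

/-- The vector `v` as an element of the lexicographically ordered group `ℝⁿ`. -/
def lx : E n →+ Lex (Fin n → ℝ) where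
  toFun v := toLex (fun i => v i)
  map_zero' := rfl
  map_add' _ _ := rfl

theorem lx_injective : Function.Injective (lx : E n → Lex (Fin n → ℝ)) := by
  intro u v h
  ext i
  exact congrFun (toLex.injective h) i

theorem lx_lt_iff {u v : E n} : lx u < lx v ↔ ∃ i, (∀ j < i, u j = v j) ∧ u i < v i := Iff.rfl

/-- `x^v` is the lexicographically leading monomial of `f`, it has coefficient one, and all exponents
of `f` are congruent to `v` modulo the root lattice of type `D_n`. -/
structure IsLead (f : GroupRing n) (v : E n) : Prop where
  coeff_self : f.coeff v = 1
  le : ∀ u, f.coeff u ≠ 0 → lx u ≤ lx v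
  sub_mem : ∀ u, f.coeff u ≠ 0 → u - v ∈ rootLattice (rootsD n)

theorem IsLead.X (v : E n) : IsLead (X v) v where
  coeff_self := by simp [coeff_X]
  le u h := by
    rw [coeff_X] at h
    simp only [ne_eq, ite_eq_right_iff, one_ne_zero, imp_false, not_not] at h
    rw [h]
  sub_mem u h := by
    rw [coeff_X] at h
    simp only [ne_eq, ite_eq_right_iff, one_ne_zero, imp_false, not_not] at h
    simp [h]

theorem IsLead.one : IsLead (1 : GroupRing n) 0 := IsLead.X 0

/-- In an ordered group, `a ≤ v`, `b ≤ w` and `a + b = v + w` force `a = v` and `b = w`, so only one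
product of terms contributes to the top coefficient. -/
theorem IsLead.mul {f g : GroupRing n} {v w : E n} (hf : IsLead f v) (hg : IsLead g w) :
    IsLead (f * g) (v + w) where
  coeff_self := by
    rw [AddMonoidAlgebra.coeff_mul_add_of_uniqueAdd, hf.coeff_self, hg.coeff_self, one_mul]
    intro a b ha hb hab
    have h1 := hf.le a (Finsupp.mem_support_iff.1 ha)
    have h2 := hg.le b (Finsupp.mem_support_iff.1 hb)
    have h3 : lx a + lx b = lx v + lx w := by rw [← map_add, ← map_add, hab]
    constructor
    · exact lx_injective (((add_eq_add_iff_eq_and_eq h1 h2).1 h3).1)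
    · exact lx_injective (((add_eq_add_iff_eq_and_eq h1 h2).1 h3).2)
  le u h := by
    obtain ⟨a, b, ha, hb, rfl⟩ := exists_of_coeff_mul_ne_zero h
    rw [map_add, map_add]
    exact add_le_add (hf.le a ha) (hg.le b hb)
  sub_mem u h := by
    obtain ⟨a, b, ha, hb, rfl⟩ := exists_of_coeff_mul_ne_zero h
    rw [add_sub_add_comm]
    exact add_mem (hf.sub_mem a ha) (hg.sub_mem b hb)

theorem IsLead.pow {f : GroupRing n} {v : E n} (hf : IsLead f v) (k : ℕ) :
    IsLead (f ^ k) (k • v) := by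
  induction k with
  | zero => simpa using IsLead.one
  | succ k ih => rw [pow_succ, succ_nsmul]; exact ih.mul hf

theorem IsLead.prod {ι : Type*} {s : Finset ι} {f : ι → GroupRing n} {v : ι → E n}
    (h : ∀ i ∈ s, IsLead (f i) (v i)) : IsLead (∏ i ∈ s, f i) (∑ i ∈ s, v i) := by
  classical
  induction s using Finset.induction_on with
  | empty => simpa using IsLead.one
  | insert a s ha ih =>
    rw [Finset.prod_insert ha, Finset.sum_insert ha]
    exact (h a (by simp)).mul (ih fun i hi => h i (by simp [hi]))

theorem IsLead.sum {ι : Type*} {s : Finset ι} {f : ι → GroupRing n} {v : ι → E n}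
    (h : ∀ i ∈ s, IsLead (f i) (v i)) {i₀ : ι} (hi₀ : i₀ ∈ s)
    (hlt : ∀ i ∈ s, i ≠ i₀ → lx (v i) < lx (v i₀))
    (hmem : ∀ i ∈ s, v i - v i₀ ∈ rootLattice (rootsD n)) : IsLead (∑ i ∈ s, f i) (v i₀) := by
  have key : ∀ u, (∑ i ∈ s, f i).coeff u = ∑ i ∈ s, (f i).coeff u := by
    intro u
    rw [AddMonoidAlgebra.coeff_sum, Finsupp.finsetSum_apply]
  have ex : ∀ u, (∑ i ∈ s, f i).coeff u ≠ 0 → ∃ i ∈ s, (f i).coeff u ≠ 0 := by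
    intro u hu
    rw [key] at hu
    exact Finset.exists_ne_zero_of_sum_ne_zero hu
  have hle : ∀ i ∈ s, lx (v i) ≤ lx (v i₀) := by
    intro i hi
    by_cases hii : i = i₀
    · rw [hii]
    · exact (hlt i hi hii).le
  refine ⟨?_, ?_, ?_⟩
  · rw [key, Finset.sum_eq_single_of_mem i₀ hi₀, (h i₀ hi₀).coeff_self]
    intro i hi hii
    by_contra hne
    exact absurd ((h i hi).le _ hne) (not_le.2 (hlt i hi hii))
  · intro u hu
    obtain ⟨i, hi, hne⟩ := ex u hu
    exact ((h i hi).le u hne).trans (hle i hi)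
  · intro u hu
    obtain ⟨i, hi, hne⟩ := ex u hu
    have := add_mem ((h i hi).sub_mem u hne) (hmem i hi)
    rwa [sub_add_sub_cancel] at this

/-! ### The root lattice of type `D_n` -/

theorem e_apply (i k : Fin n) : (e i : E n) k = if k = i then 1 else 0 := by
  simp [e]

theorem e_add_mem {i j : Fin n} (hij : i ≠ j) (s t : ℤˣ) :
    (s : ℤ) • (e i : E n) + (t : ℤ) • e j ∈ rootLattice (rootsD n) := by
  apply AddSubgroup.subset_closure
  rcases lt_or_gt_of_ne hij with h | h
  · exact ⟨i, j, h, s, t, rfl⟩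
  · exact ⟨j, i, h, t, s, add_comm _ _⟩

theorem sum_smul_e (v : E n) : v = ∑ i, v i • e i := by
  ext k
  simp [e_apply]

/-- The usual coordinates of the lattice `D_n`: both conditions hold for roots and pass to sums and
negatives. Conversely such vectors are combinations of `e_i - e_1` and `2 e_1`. -/
theorem mem_rootLattice_iff (hn : 2 ≤ n) (v : E n) :
    v ∈ rootLattice (rootsD n) ↔
      (∀ k, ∃ z : ℤ, v k = (z : ℝ)) ∧ ∃ z : ℤ, ∑ k, v k = 2 * (z : ℝ) := by
  constructor
  · intro h
    induction h using AddSubgroup.closure_induction with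
    | mem x hx =>
      obtain ⟨i, j, hij, s, t, rfl⟩ := hx
      constructor
      · intro k
        refine ⟨s * (if k = i then 1 else 0) + t * (if k = j then 1 else 0), ?_⟩
        simp [e_apply]
      · have : ∑ k, ((s : ℤ) • e i + (t : ℤ) • e j : E n) k = ((s : ℤ) : ℝ) + ((t : ℤ) : ℝ) := by
          simp [e_apply, Finset.sum_add_distrib]
        rw [this]
        rcases Int.units_eq_one_or s with rfl | rfl <;> rcases Int.units_eq_one_or t with rfl | rfl
        · exact ⟨1, by norm_num⟩
        · exact ⟨0, by norm_num⟩
        · exact ⟨0, by norm_num⟩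
        · exact ⟨-1, by norm_num⟩
    | zero => exact ⟨fun k => ⟨0, by simp⟩, 0, by simp⟩
    | add x y _ _ hx hy =>
      obtain ⟨hx1, a, hx2⟩ := hx
      obtain ⟨hy1, b, hy2⟩ := hy
      refine ⟨fun k => ?_, a + b, ?_⟩
      · obtain ⟨p, hp⟩ := hx1 k
        obtain ⟨q, hq⟩ := hy1 k
        exact ⟨p + q, by simp [hp, hq]⟩
      · simp only [PiLp.add_apply, Finset.sum_add_distrib, hx2, hy2]
        push_cast; ring
    | neg x _ hx =>
      obtain ⟨hx1, a, hx2⟩ := hx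
      refine ⟨fun k => ?_, -a, ?_⟩
      · obtain ⟨p, hp⟩ := hx1 k
        exact ⟨-p, by simp [hp]⟩
      · simp only [PiLp.neg_apply, Finset.sum_neg_distrib, hx2]
        push_cast; ring
  · rintro ⟨h1, z, hz⟩
    choose c hc using h1
    let o : Fin n := ⟨0, by omega⟩
    let p : Fin n := ⟨1, by omega⟩
    have hop : o ≠ p := by simp [o, p]
    -- `2 e_o = (e_o + e_p) + (e_o - e_p)`; this is where a second coordinate is needed.
    have h2 : (2 : ℤ) • (e o : E n) ∈ rootLattice (rootsD n) := by
      have := add_mem (e_add_mem hop 1 1) (e_add_mem hop 1 (-1))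
      convert this using 1
      simp only [Units.val_one, Units.val_neg]
      module
    have h3 : ∀ i, (e i : E n) - e o ∈ rootLattice (rootsD n) := by
      intro i
      by_cases hi : i = o
      · simp [hi]
      · have := e_add_mem hi 1 (-1)
        convert this using 1
        simp only [Units.val_one, Units.val_neg]
        module
    have h4 : v = ∑ i, c i • (e i - e o) + z • (2 : ℤ) • e o := by
      have hcz : ∑ i, c i = 2 * z := by
        have : ((∑ i, c i : ℤ) : ℝ) = ((2 * z : ℤ) : ℝ) := by
          push_cast
          rw [← hz]
          exact Finset.sum_congr rfl fun i _ => (hc i).symm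
        exact_mod_cast this
      have h5 : v = ∑ i, c i • e i := by
        conv_lhs => rw [sum_smul_e v]
        refine Finset.sum_congr rfl fun i _ => ?_
        rw [hc i, Int.cast_smul_eq_zsmul]
      simp only [smul_sub, Finset.sum_sub_distrib, ← Finset.sum_smul, hcz]
      rw [← h5]
      module
    rw [h4]
    exact add_mem (sum_mem fun i _ => zsmul_mem (h3 i) _) (zsmul_mem h2 z)

/-! ### The Weyl group of type `D_n` -/

/-- The root `s e_i + t e_j`. -/
noncomputable def rootD (i j : Fin n) (s t : ℤˣ) : E n := (s : ℤ) • e i + (t : ℤ) • e j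

/-- The reflection in the hyperplane orthogonal to `s e_i + t e_j`. -/
noncomputable def reflD (i j : Fin n) (s t : ℤˣ) : E n ≃ₗᵢ[ℝ] E n :=
  (Submodule.span ℝ {rootD i j s t})ᗮ.reflection

theorem reflD_mem {i j : Fin n} (hij : i < j) (s t : ℤˣ) : reflD i j s t ∈ weylGroup (rootsD n) :=
  Subgroup.subset_closure ⟨_, ⟨i, j, hij, s, t, rfl⟩, rfl⟩

theorem inner_e (i : Fin n) (v : E n) : inner ℝ (e i) v = v i := by
  simp [e, EuclideanSpace.inner_single_left]

theorem inner_rootD (i j : Fin n) (s t : ℤˣ) (v : E n) :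
    inner ℝ (rootD i j s t) v = (s : ℤ) * v i + (t : ℤ) * v j := by
  simp only [rootD, ← Int.cast_smul_eq_zsmul ℝ, inner_add_left, inner_smul_left, inner_e]
  simp

theorem cast_units_mul_self (s : ℤˣ) : ((s : ℤ) : ℝ) * ((s : ℤ) : ℝ) = 1 := by
  rcases Int.units_eq_one_or s with rfl | rfl <;> norm_num

/-- The root has squared length 2, so the reflection is `v ↦ v - ⟨α, v⟩ α` without denominators; in
coordinates it is a signed transposition. -/
theorem reflD_apply {i j : Fin n} (hij : i ≠ j) (s t : ℤˣ) (v : E n) (k : Fin n) :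
    reflD i j s t v k
      = (((if k = i ∨ k = j then -(s * t) else 1 : ℤˣ) : ℤ) : ℝ) * v (Equiv.swap i j k) := by
  have hn : ‖rootD i j s t‖ ^ 2 = 2 := by
    rw [← real_inner_self_eq_norm_sq, inner_rootD]
    simp only [rootD, ← Int.cast_smul_eq_zsmul ℝ, PiLp.add_apply, PiLp.smul_apply, e_apply, hij,
      hij.symm, if_true, if_false, smul_eq_mul]
    have h1 := cast_units_mul_self s
    have h2 := cast_units_mul_self t
    linarith
  have h : reflD i j s t v = v - ((s : ℤ) * v i + (t : ℤ) * v j : ℝ) • rootD i j s t := by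
    rw [reflD, Submodule.reflection_orthogonal_apply, Submodule.reflection_singleton_apply,
      inner_rootD]
    simp only [RCLike.ofReal_real_eq_id, id_eq, hn]
    module
  rw [h]
  have h1 := cast_units_mul_self s
  have h2 := cast_units_mul_self t
  simp only [rootD, ← Int.cast_smul_eq_zsmul ℝ, PiLp.sub_apply, PiLp.add_apply, PiLp.smul_apply,
    e_apply, smul_eq_mul]
  by_cases hki : k = i
  · subst hki
    simp only [hij, Equiv.swap_apply_left, true_or, if_true, if_false]
    push_cast
    linear_combination (-v k) * h1
  · by_cases hkj : k = j
    · subst hkj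
      simp only [hij.symm, Equiv.swap_apply_right, or_true, if_true, if_false]
      push_cast
      linear_combination (-v k) * h2
    · simp [hki, hkj, Equiv.swap_apply_of_ne_of_ne hki hkj]

theorem weylGroup_induction {p : (E n ≃ₗᵢ[ℝ] E n) → Prop}
    (refl : ∀ i j s t, i < j → p (reflD i j s t)) (one : p 1)
    (mul : ∀ x y, p x → p y → p (x * y)) (inv : ∀ x, p x → p x⁻¹)
    {w : E n ≃ₗᵢ[ℝ] E n} (hw : w ∈ weylGroup (rootsD n)) : p w := by
  induction hw using Subgroup.closure_induction with
  | mem x hx =>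
    obtain ⟨α, ⟨i, j, hij, s, t, rfl⟩, rfl⟩ := hx
    exact refl i j s t hij
  | one => exact one
  | mul x y _ _ hx hy => exact mul x y hx hy
  | inv x _ hx => exact inv x hx

theorem act_X (w : E n ≃ₗᵢ[ℝ] E n) (v : E n) : act w (X v) = X (w v) := by
  simp [act, X]

theorem act_one (f : GroupRing n) : act 1 f = f := by
  have : act (1 : E n ≃ₗᵢ[ℝ] E n) = AlgHom.id ℤ _ := by
    refine AddMonoidAlgebra.algHom_ext (fun v => ?_) (Subsingleton.elim _ _)
    exact act_X _ _
  rw [this]; rfl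

theorem act_mul (w w' : E n ≃ₗᵢ[ℝ] E n) (f : GroupRing n) : act (w * w') f = act w (act w' f) := by
  have : act (w * w') = (act w).comp (act w') := by
    refine AddMonoidAlgebra.algHom_ext (fun v => ?_) (Subsingleton.elim _ _)
    change act _ (X v) = act _ (act _ (X v))
    rw [act_X, act_X, act_X]; rfl
  rw [this]; rfl

theorem coeff_act (w : E n ≃ₗᵢ[ℝ] E n) (f : GroupRing n) (v : E n) :
    (act w f).coeff (w v) = f.coeff v :=
  Finsupp.mapDomain_apply w.injective f.coeff v

theorem mem_latticeRing_iff (L : AddSubgroup (E n)) (f : GroupRing n) :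
    f ∈ latticeRing L ↔ ∀ v, f.coeff v ≠ 0 → v ∈ L := by
  constructor
  · rintro ⟨g, rfl⟩ v hv
    by_contra h
    apply hv
    exact Finsupp.mapDomain_of_notMem_range g.coeff v (by simpa using h)
  · intro h
    refine ⟨AddMonoidAlgebra.comapDomain L.subtype Subtype.val_injective f, ?_⟩
    apply AddMonoidAlgebra.mapDomain_comapDomain
    intro v hv
    simpa using h v (Finsupp.mem_support_iff.1 hv)

/-- The isometries fixing `f` are closed under products and inverses, so the generating reflections
suffice. -/
theorem act_eq_self {f : GroupRing n} (h : ∀ i j s t, i < j → act (reflD i j s t) f = f)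
    {w : E n ≃ₗᵢ[ℝ] E n} (hw : w ∈ weylGroup (rootsD n)) : act w f = f := by
  refine weylGroup_induction (p := fun w => act w f = f) h (act_one f) ?_ ?_ hw
  · intro x y hx hy
    rw [act_mul, hy, hx]
  · intro x hx
    conv_lhs => rw [← hx, ← act_mul, inv_mul_cancel, act_one]

theorem mem_invariants_iff (f : GroupRing n) :
    f ∈ invariants (rootsD n) ↔ (∀ v, f.coeff v ≠ 0 → v ∈ rootLattice (rootsD n)) ∧
      ∀ i j s t, i < j → act (reflD i j s t) f = f := by
  rw [invariants, Algebra.mem_inf, mem_latticeRing_iff]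
  simp only [Algebra.mem_iInf, AlgHom.mem_equalizer, AlgHom.id_apply]
  exact and_congr_right fun _ =>
    ⟨fun h i j s t hij => h _ (reflD_mem hij s t), fun h w hw => act_eq_self h hw⟩

/-! ### Invariance of `σ_i` -/

theorem reflD_e {i j : Fin n} (hij : i ≠ j) (s t : ℤˣ) (k : Fin n) :
    reflD i j s t (e k) = ((if k = i ∨ k = j then -(s * t) else 1 : ℤˣ) : ℤ) •
      e (Equiv.swap i j k) := by
  ext l
  rw [reflD_apply hij, ← Int.cast_smul_eq_zsmul ℝ, PiLp.smul_apply, e_apply, e_apply, smul_eq_mul]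
  by_cases h : l = Equiv.swap i j k
  · subst h
    have : (Equiv.swap i j k = i ∨ Equiv.swap i j k = j) ↔ (k = i ∨ k = j) := by
      rw [Equiv.swap_apply_eq_iff, Equiv.swap_apply_eq_iff, Equiv.swap_apply_left,
        Equiv.swap_apply_right, or_comm]
    simp [this]
  · have h' : Equiv.swap i j l ≠ k := fun h2 => h (by rw [← h2, Equiv.swap_apply_self])
    simp [h, h']

theorem sigma_eq_aeval (n i : ℕ) :
    sigma n i = MvPolynomial.aeval (fun j => X (e j) + X (-e j)) (MvPolynomial.esymm (Fin n) ℤ i) := by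
  simp [sigma, MvPolynomial.esymm]

/-- The sign of a signed transposition is absorbed by `x_k + x_k⁻¹`, so these elements are merely
permuted, and `σ_m` is symmetric in them. -/
theorem act_reflD_sigma {i j : Fin n} (hij : i ≠ j) (s t : ℤˣ) (m : ℕ) :
    act (reflD i j s t) (sigma n m) = sigma n m := by
  rw [sigma_eq_aeval, ← AlgHom.comp_apply, MvPolynomial.comp_aeval]
  have h : (fun k => act (reflD i j s t) (X (e k) + X (-e k)))
      = (fun k => X (e k : E n) + X (-e k)) ∘ Equiv.swap i j := by
    funext k
    rw [map_add, act_X, act_X, map_neg, reflD_e hij]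
    rcases Int.units_eq_one_or (if k = i ∨ k = j then -(s * t) else 1) with h | h
    · rw [h]; simp
    · rw [h]; simp [add_comm]
  rw [h, ← MvPolynomial.aeval_rename, MvPolynomial.rename_esymm]

/-! ### Half-spin weights, orbits and invariance of `τ_±` -/

/-- The vector `(d_1, …, d_n) / 2`. -/
noncomputable def half (d : Fin n → ℤˣ) : E n := ∑ i, (((d i : ℤ) : ℝ) / 2) • e i

theorem half_apply (d : Fin n → ℤˣ) (k : Fin n) : half d k = ((d k : ℤ) : ℝ) / 2 := by
  simp [half, e_apply]

theorem half_injective : Function.Injective (half : (Fin n → ℤˣ) → E n) := by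
  intro c d h
  funext k
  have := congrArg (fun v : E n => v k) h
  simp only [half_apply] at this
  apply Units.ext
  have h2 : ((c k : ℤ) : ℝ) = ((d k : ℤ) : ℝ) := by linarith
  exact_mod_cast h2

theorem tau_eq (n : ℕ) (s : ℤˣ) : tau n s = ∑ d : Fin n → ℤˣ with ∏ i, d i = s, X (half d) := by
  simp only [tau, half, prod_X]

/-- The signed transposition through which `reflD i j s t` acts on half-spin weights. -/
def signSwap (i j : Fin n) (s t : ℤˣ) (d : Fin n → ℤˣ) : Fin n → ℤˣ :=
  fun k => (if k = i ∨ k = j then -(s * t) else 1) * d (Equiv.swap i j k)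

theorem reflD_half {i j : Fin n} (hij : i ≠ j) (s t : ℤˣ) (d : Fin n → ℤˣ) :
    reflD i j s t (half d) = half (signSwap i j s t d) := by
  ext k
  rw [reflD_apply hij, half_apply, half_apply, signSwap]
  push_cast
  ring

theorem prod_signSwap {i j : Fin n} (hij : i ≠ j) (s t : ℤˣ) (d : Fin n → ℤˣ) :
    ∏ k, signSwap i j s t d k = ∏ k, d k := by
  have h : ∏ k : Fin n, (if k = i ∨ k = j then -(s * t) else 1 : ℤˣ) = 1 := by
    rw [Finset.prod_ite, Finset.prod_const, Finset.prod_const_one, mul_one,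
      Finset.filter_or, Finset.filter_eq', Finset.filter_eq']
    simp only [Finset.mem_univ, if_true]
    have : ({i} ∪ {j} : Finset (Fin n)).card = 2 := by
      rw [← Finset.insert_eq, Finset.card_pair hij]
    rw [this]
    exact Int.units_sq _
  simp only [signSwap, Finset.prod_mul_distrib, h, one_mul]
  exact Equiv.prod_comp (Equiv.swap i j) d

/-- The set of half-spin weights with a given product of signs. -/
def spinSet (n : ℕ) (s : ℤˣ) : Set (E n) := half '' {d | ∏ i, d i = s}

/-- Equality rather than inclusion is proved because it passes directly to inverses in the induction
over the generated group. -/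
theorem weyl_mem_spinSet {r : ℤˣ} {w : E n ≃ₗᵢ[ℝ] E n} (hw : w ∈ weylGroup (rootsD n)) :
    w '' spinSet n r = spinSet n r := by
  have inc : ∀ i j s t, i < j → reflD i j s t '' spinSet n r ⊆ spinSet n r := by
    rintro i j s t hij _ ⟨_, ⟨d, hd, rfl⟩, rfl⟩
    rw [reflD_half hij.ne]
    exact ⟨_, (prod_signSwap hij.ne s t d).trans hd, rfl⟩
  refine weylGroup_induction (p := fun w => w '' spinSet n r = spinSet n r) ?_ ?_ ?_ ?_ hw
  · intro i j s t hij
    apply subset_antisymm (inc i j s t hij)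
    intro v hv
    refine ⟨reflD i j s t v, inc i j s t hij ⟨v, hv, rfl⟩, ?_⟩
    exact Submodule.reflection_reflection _ v
  · exact Set.image_id _
  · intro x y hx hy
    calc (x * y) '' spinSet n r = x '' (y '' spinSet n r) := by rw [← Set.image_comp]; rfl
      _ = _ := by rw [hy, hx]
  · intro x hx
    conv_lhs => rw [← hx, ← Set.image_comp]
    convert Set.image_id _
    funext v
    exact x.symm_apply_apply v

theorem act_reflD_tau {i j : Fin n} (hij : i ≠ j) (s t r : ℤˣ) :
    act (reflD i j s t) (tau n r) = tau n r := by
  have inv : ∀ d : Fin n → ℤˣ, signSwap i j s t (signSwap i j s t d) = d := by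
    intro d
    apply half_injective
    rw [← reflD_half hij, ← reflD_half hij]
    exact Submodule.reflection_reflection _ _
  rw [tau_eq, map_sum]
  simp only [act_X, reflD_half hij]
  refine Finset.sum_nbij' (signSwap i j s t) (signSwap i j s t) ?_ ?_ ?_ ?_ ?_
  · intro d hd
    simpa [prod_signSwap hij] using hd
  · intro d hd
    simpa [prod_signSwap hij] using hd
  · intro d _; exact inv d
  · intro d _; exact inv d
  · intro d _; rfl

/-- Induction on the number of places where the signs disagree. Equal products exclude a single
disagreement, and two disagreements are removed together by one reflection. -/
theorem exists_weyl_half (c : Fin n → ℤˣ) (d : Fin n → ℤˣ) (h : ∏ i, d i = ∏ i, c i) :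
    ∃ w ∈ weylGroup (rootsD n), w (half c) = half d := by
  induction hm : (Finset.univ.filter fun i => d i ≠ c i).card using Nat.strong_induction_on
    generalizing d with
  | _ m ih =>
  by_cases hdc : d = c
  · exact ⟨1, one_mem _, by rw [hdc]; rfl⟩
  · obtain ⟨i, hi⟩ := Function.ne_iff.1 hdc
    have hj : ∃ j, j ≠ i ∧ d j ≠ c j := by
      by_contra! hall
      apply hi
      rw [← Finset.mul_prod_erase _ d (Finset.mem_univ i),
        ← Finset.mul_prod_erase _ c (Finset.mem_univ i),
        Finset.prod_congr rfl fun j hj => hall j (Finset.ne_of_mem_erase hj)] at h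
      exact mul_right_cancel h
    obtain ⟨j, hji, hj⟩ := hj
    have neg : ∀ x y : ℤˣ, x ≠ y → -x = y := by decide
    have key : ∀ i j, i ≠ j → d i ≠ c i → d j ≠ c j → i < j →
        ∃ w ∈ weylGroup (rootsD n), w (half c) = half d := by
      intro i j hij hi hj hlt
      -- The root `e_i + d_i d_j e_j` is proportional to `d_i e_i + d_j e_j`, so its reflection
      -- flips exactly the signs at `i` and `j`.
      have sw : ∀ k, signSwap i j 1 (d i * d j) d k = if k = i ∨ k = j then c k else d k := by
        intro k
        simp only [signSwap]
        by_cases hki : k = i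
        · subst hki
          simp only [true_or, if_true, Equiv.swap_apply_left, ← neg _ _ hi]
          rw [one_mul, neg_mul, mul_assoc, Int.units_mul_self, mul_one]
        · by_cases hkj : k = j
          · subst hkj
            simp only [or_true, if_true, Equiv.swap_apply_right, ← neg _ _ hj]
            rw [one_mul, neg_mul, mul_right_comm, Int.units_mul_self, one_mul]
          · simp [hki, hkj, Equiv.swap_apply_of_ne_of_ne hki hkj]
      have hcard : (Finset.univ.filter fun k => signSwap i j 1 (d i * d j) d k ≠ c k).card < m := by
        rw [← hm]
        apply Finset.card_lt_card
        refine ⟨fun k hk => ?_, fun hsub => ?_⟩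
        · simp only [Finset.mem_filter, Finset.mem_univ, true_and, sw] at hk ⊢
          by_cases hk' : k = i ∨ k = j
          · simp [hk'] at hk
          · simpa [hk'] using hk
        · have := hsub (show i ∈ _ by simpa using hi)
          simp [sw] at this
      obtain ⟨w, hw, hwc⟩ := ih _ hcard (signSwap i j 1 (d i * d j) d)
        ((prod_signSwap hij _ _ d).trans h) rfl
      refine ⟨reflD i j 1 (d i * d j) * w, mul_mem (reflD_mem hlt _ _) hw, ?_⟩
      change reflD i j 1 (d i * d j) (w (half c)) = _
      rw [hwc, ← reflD_half hij]
      exact Submodule.reflection_reflection _ _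
    rcases lt_or_gt_of_ne hji with hlt | hlt
    · exact key j i hji hj hi hlt
    · exact key i j hji.symm hi hj hlt

/-- The orbit is all of `spinSet`: reflections preserve the product of signs, and `exists_weyl_half`
gives transitivity. -/
theorem orbitSum_half (c : Fin n → ℤˣ) : orbitSum (rootsD n) (half c) = tau n (∏ i, c i) := by
  have h : {u : E n | ∃ w ∈ weylGroup (rootsD n), w (half c) = u} = spinSet n (∏ i, c i) := by
    ext u
    constructor
    · rintro ⟨w, hw, rfl⟩
      rw [← weyl_mem_spinSet hw]
      exact ⟨_, ⟨c, rfl, rfl⟩, rfl⟩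
    · rintro ⟨d, hd, rfl⟩
      exact exists_weyl_half c d hd
  rw [orbitSum, h, spinSet, finsum_mem_image half_injective.injOn, tau_eq,
    ← finsum_mem_coe_finset]
  simp

/-- The signs `(1, …, 1, -1)` of the weight `spinMinus n`. -/
def minusSigns (n : ℕ) : Fin n → ℤˣ := fun i => if (i : ℕ) + 1 = n then -1 else 1

theorem spinPlus_eq (n : ℕ) : spinPlus n = half 1 := by simp [spinPlus, half]

theorem spinMinus_eq (n : ℕ) : spinMinus n = half (minusSigns n) := by
  refine Finset.sum_congr rfl fun i _ => ?_
  unfold minusSigns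
  split_ifs <;> simp

theorem prod_minusSigns (hn : 0 < n) : ∏ i, minusSigns n i = -1 := by
  rw [Finset.prod_eq_single (⟨n - 1, by omega⟩ : Fin n)]
  · simp [minusSigns]; omega
  · intro k _ hk
    have : (k : ℕ) + 1 ≠ n := fun h => hk (Fin.ext (by simp; omega))
    simp [minusSigns, this]
  · simp

/-! ### Leading exponents of `σ_i` and `τ_±` -/

theorem IsLead.add_of_lt {f g : GroupRing n} {v w : E n} (hf : IsLead f v) (hg : IsLead g w)
    (hlt : lx w < lx v) (hmem : w - v ∈ rootLattice (rootsD n)) : IsLead (f + g) v := by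
  have := IsLead.sum (s := (Finset.univ : Finset Bool)) (f := fun b => cond b f g)
    (v := fun b => cond b v w) (i₀ := true) (by rintro (_ | _) _ <;> assumption)
    (Finset.mem_univ _) (by rintro (_ | _) _ h; exacts [hlt, absurd rfl h])
    (by rintro (_ | _) _; exacts [hmem, by simp])
  simpa using this

theorem isLead_X_e_add (hn : 2 ≤ n) (j : Fin n) : IsLead (X (e j) + X (-e j)) (e j) := by
  refine (IsLead.X _).add_of_lt (IsLead.X _) ?_ ?_
  · rw [lx_lt_iff]
    refine ⟨j, fun k hk => ?_, ?_⟩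
    · simp [e_apply, hk.ne]
    · rw [PiLp.neg_apply, e_apply, if_pos rfl]; norm_num
  · rw [mem_rootLattice_iff hn]
    refine ⟨fun k => ⟨if k = j then -2 else 0, ?_⟩, -1, ?_⟩
    · rw [PiLp.sub_apply, PiLp.neg_apply, e_apply]
      split_ifs <;> norm_num
    · simp [e_apply]; norm_num

/-- The fundamental weight `e_1 + ⋯ + e_i`. -/
noncomputable def fundWeight (n i : ℕ) : E n := ∑ j ∈ Finset.univ.filter fun j : Fin n => (j : ℕ) < i, e j

theorem sum_e_apply (I : Finset (Fin n)) (k : Fin n) :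
    (∑ j ∈ I, e j : E n) k = if k ∈ I then 1 else 0 := by
  simp [e_apply]

theorem fundWeight_apply (i : ℕ) (k : Fin n) :
    fundWeight n i k = if (k : ℕ) < i then 1 else 0 := by
  simp [fundWeight, e_apply]

/-- The summand of `I` has leading exponent `∑_{j ∈ I} e_j`. Among sets of size `i` the initial
segment is lexicographically largest: compare at the first element of it missing from `I`. -/
theorem isLead_sigma (hn : 2 ≤ n) {i : ℕ} (hi : i ≤ n) : IsLead (sigma n i) (fundWeight n i) := by
  set I₀ : Finset (Fin n) := Finset.univ.filter fun j => (j : ℕ) < i with hI₀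
  have hc : I₀.card = i := by
    rw [hI₀, Fin.card_filter_val_lt, min_eq_right hi]
  refine IsLead.sum (s := Finset.powersetCard i Finset.univ) (v := fun I => ∑ j ∈ I, e j) (i₀ := I₀)
    (fun I _ => IsLead.prod fun j _ => isLead_X_e_add hn j) (by simp [hc]) ?_ ?_
  · intro I hI hne
    rw [Finset.mem_powersetCard_univ] at hI
    have hex : (I₀ \ I).Nonempty := by
      rw [Finset.sdiff_nonempty]
      intro hsub
      exact hne (Finset.eq_of_subset_of_card_le hsub (by omega)).symm
    obtain ⟨k, hk, hmin⟩ := Finset.exists_min_image _ id hex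
    rw [Finset.mem_sdiff] at hk
    rw [lx_lt_iff]
    refine ⟨k, fun j hj => ?_, ?_⟩
    · have hj0 : j ∈ I₀ := by
        have := hk.1
        simp only [hI₀, Finset.mem_filter, Finset.mem_univ, true_and] at this ⊢
        have : (j : ℕ) < k := hj
        omega
      have hjI : j ∈ I := by
        by_contra h
        exact absurd (hmin j (Finset.mem_sdiff.2 ⟨hj0, h⟩)) (not_le.2 hj)
      rw [sum_e_apply, sum_e_apply, if_pos hj0, if_pos hjI]
    · rw [sum_e_apply, sum_e_apply, if_pos hk.1, if_neg hk.2]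
      exact one_pos
  · intro I hI
    rw [Finset.mem_powersetCard_univ] at hI
    rw [mem_rootLattice_iff hn]
    refine ⟨fun k => ⟨(if k ∈ I then 1 else 0) - (if k ∈ I₀ then 1 else 0), ?_⟩, 0, ?_⟩
    · rw [PiLp.sub_apply, sum_e_apply, sum_e_apply]
      push_cast; rfl
    · simp only [PiLp.sub_apply, sum_e_apply, Finset.sum_sub_distrib, Finset.sum_boole,
        Finset.filter_univ_mem, hc, hI]
      simp

/-- The first disagreement is not at the last place, since equal products would then force agreement
there too. Hence it occurs where `c` is `1` and `d` is `-1`. -/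
theorem lx_half_lt {c d : Fin n → ℤˣ} (hc : ∀ k : Fin n, (k : ℕ) + 1 < n → c k = 1)
    (h : ∏ i, d i = ∏ i, c i) (hdc : d ≠ c) : lx (half d) < lx (half c) := by
  have hex : (Finset.univ.filter fun k => d k ≠ c k).Nonempty := by
    obtain ⟨k, hk⟩ := Function.ne_iff.1 hdc
    exact ⟨k, by simpa using hk⟩
  obtain ⟨k, hk, hmin⟩ := Finset.exists_min_image _ id hex
  have hk' : d k ≠ c k := by simpa using hk
  have heq : ∀ j < k, d j = c j := by
    intro j hj
    by_contra hne
    exact absurd (hmin j (by simpa using hne)) (not_le.2 hj)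
  have hlt : (k : ℕ) + 1 < n := by
    by_contra hge
    apply hk'
    rw [← Finset.mul_prod_erase _ d (Finset.mem_univ k),
      ← Finset.mul_prod_erase _ c (Finset.mem_univ k), Finset.prod_congr rfl fun j hj =>
        heq j (lt_of_le_of_ne (Fin.le_def.2 (by omega)) (Finset.ne_of_mem_erase hj))] at h
    exact mul_right_cancel h
  rw [lx_lt_iff]
  refine ⟨k, fun j hj => ?_, ?_⟩
  · rw [half_apply, half_apply, heq j hj]
  · have h1 := hc k hlt
    have h2 : d k = -1 := (Int.units_eq_one_or (d k)).resolve_left (h1 ▸ hk')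
    rw [half_apply, half_apply, h1, h2]
    norm_num

/-- With `a_k ∈ {0, 1}` marking the minus signs, the coordinates are `1/2 - a_k` and the product of
signs is the parity of `∑ a_k`. -/
theorem half_sub_half_mem (hn : 2 ≤ n) {c d : Fin n → ℤˣ} (h : ∏ i, d i = ∏ i, c i) :
    half d - half c ∈ rootLattice (rootsD n) := by
  have key : ∀ d : Fin n → ℤˣ, ∃ a : Fin n → ℕ, (∀ k, half d k = 1 / 2 - a k) ∧
      ∏ k, d k = (-1) ^ (∑ k, a k) := by
    intro d
    have : ∀ k, ∃ a : ℕ, half d k = 1 / 2 - a ∧ d k = (-1) ^ a := by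
      intro k
      rcases Int.units_eq_one_or (d k) with h | h
      · exact ⟨0, by rw [half_apply, h]; norm_num, by simp [h]⟩
      · exact ⟨1, by rw [half_apply, h]; norm_num, by simp [h]⟩
    choose a h1 h2 using this
    refine ⟨a, h1, ?_⟩
    rw [← Finset.prod_pow_eq_pow_sum]
    exact Finset.prod_congr rfl fun k _ => h2 k
  obtain ⟨a, ha, ha'⟩ := key d
  obtain ⟨b, hb, hb'⟩ := key c
  have hpar : Even (∑ k, (b k : ℤ) - ∑ k, (a k : ℤ)) := by
    rw [ha', hb'] at h
    have h3 : Even (∑ k, a k) ↔ Even (∑ k, b k) := by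
      have hh : ∀ m : ℕ, Even m ↔ (-1 : ℤˣ) ^ m = 1 := fun m =>
        (neg_one_pow_eq_one_iff_even (by decide)).symm
      rw [hh, hh, h]
    rw [Int.even_sub, ← Nat.cast_sum, ← Nat.cast_sum, Int.even_coe_nat, Int.even_coe_nat]
    exact h3.symm
  rw [mem_rootLattice_iff hn]
  refine ⟨fun k => ⟨b k - a k, ?_⟩, ?_⟩
  · rw [PiLp.sub_apply, ha, hb]
    push_cast; ring
  · obtain ⟨z, hz⟩ := hpar
    refine ⟨z, ?_⟩
    have hz' : ∑ k, (b k : ℝ) - ∑ k, (a k : ℝ) = z + z := by exact_mod_cast hz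
    rw [two_mul, ← hz', ← Finset.sum_sub_distrib]
    refine Finset.sum_congr rfl fun k _ => ?_
    rw [PiLp.sub_apply, ha, hb]
    ring

theorem isLead_tau (hn : 2 ≤ n) {c : Fin n → ℤˣ} (hc : ∀ k : Fin n, (k : ℕ) + 1 < n → c k = 1) :
    IsLead (tau n (∏ i, c i)) (half c) := by
  rw [tau_eq]
  refine IsLead.sum (v := half) (i₀ := c) (fun d _ => IsLead.X _) (by simp) ?_ ?_
  · intro d hd hne
    exact lx_half_lt hc (by simpa using hd) hne
  · intro d hd
    exact half_sub_half_mem hn (by simpa using hd)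

theorem isLead_tau_one (hn : 2 ≤ n) : IsLead (tau n 1) (spinPlus n) := by
  have := isLead_tau (c := (1 : Fin n → ℤˣ)) hn (fun _ _ => rfl)
  simpa [spinPlus_eq] using this

theorem isLead_tau_neg_one (hn : 2 ≤ n) : IsLead (tau n (-1)) (spinMinus n) := by
  have := isLead_tau (c := minusSigns n) hn (fun k hk => by simp [minusSigns, hk.ne])
  rwa [prod_minusSigns (by omega), ← spinMinus_eq] at this

/-! ### The weight of a monomial -/

/-- The dominant weight `∑ l_i ω_i`, the leading exponent of `mono l`. -/
noncomputable def wt (l : Fin n → ℕ) : E n :=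
  ∑ i ∈ Finset.Icc 1 (n - 2), entry l i • fundWeight n i + entry l (n - 1) • spinMinus n
    + entry l n • spinPlus n

theorem isLead_mono (hn : 2 ≤ n) (l : Fin n → ℕ) : IsLead (mono l) (wt l) := by
  refine ((IsLead.prod fun i hi => ?_).mul ((isLead_tau_neg_one hn).pow _)).mul
    ((isLead_tau_one hn).pow _)
  have := (Finset.mem_Icc.1 hi).2
  exact (isLead_sigma hn (by omega)).pow _

theorem spinPlus_apply (k : Fin n) : spinPlus n k = 1 / 2 := by
  rw [spinPlus_eq, half_apply]; simp

theorem spinMinus_apply (k : Fin n) :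
    spinMinus n k = if (k : ℕ) + 1 = n then -1 / 2 else 1 / 2 := by
  rw [spinMinus_eq, half_apply, minusSigns]
  split_ifs <;> simp

theorem wt_apply (l : Fin n → ℕ) (k : Fin n) :
    wt l k = ∑ j ∈ Finset.Icc 1 (n - 2), (if (k : ℕ) < j then (entry l j : ℝ) else 0)
      + entry l (n - 1) * (if (k : ℕ) + 1 = n then -1 / 2 else 1 / 2) + entry l n * (1 / 2) := by
  simp only [wt, PiLp.add_apply, PiLp.smul_apply, spinPlus_apply, spinMinus_apply, nsmul_eq_mul]
  congr 2
  rw [WithLp.ofLp_sum, Finset.sum_apply]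
  refine Finset.sum_congr rfl fun j _ => ?_
  rw [PiLp.smul_apply, fundWeight_apply, nsmul_eq_mul]
  split_ifs <;> simp

theorem wt_last (l : Fin n → ℕ) {k : Fin n} (hk : (k : ℕ) + 1 = n) :
    wt l k = ((entry l n : ℝ) - entry l (n - 1)) / 2 := by
  rw [wt_apply, if_pos hk, Finset.sum_eq_zero]
  · ring
  · intro j hj
    rw [Finset.mem_Icc] at hj
    rw [if_neg (by omega)]

/-- Pairing with a simple root `e_k - e_k'` reads off one coefficient. Coordinates count from 0 and
entries from 1, so the value of `k'` is the entry number belonging to `k`. -/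
theorem wt_sub (l : Fin n → ℕ) {k k' : Fin n} (h : (k' : ℕ) = k + 1) :
    wt l k - wt l k' = entry l k' := by
  have hk' := k'.2
  rw [wt_apply, wt_apply, if_neg (show ¬ (k : ℕ) + 1 = n by omega)]
  have hs : ∑ j ∈ Finset.Icc 1 (n - 2), (if (k : ℕ) < j then (entry l j : ℝ) else 0)
      = ∑ j ∈ Finset.Icc 1 (n - 2), (if (k' : ℕ) < j then (entry l j : ℝ) else 0)
        + ∑ j ∈ Finset.Icc 1 (n - 2), (if (k' : ℕ) = j then (entry l j : ℝ) else 0) := by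
    rw [← Finset.sum_add_distrib]
    refine Finset.sum_congr rfl fun j _ => ?_
    rcases lt_trichotomy (k' : ℕ) j with h' | h' | h'
    · rw [if_pos (by omega), if_pos h', if_neg (by omega), add_zero]
    · rw [if_pos (by omega), if_neg (by omega), if_pos h', zero_add]
    · rw [if_neg (by omega), if_neg (by omega), if_neg (by omega), zero_add]
  rw [hs, Finset.sum_ite_eq]
  by_cases hlast : (k' : ℕ) + 1 = n
  · rw [if_pos hlast, if_neg (by rw [Finset.mem_Icc]; omega), show n - 1 = (k' : ℕ) by omega]
    ring
  · rw [if_neg hlast, if_pos (by rw [Finset.mem_Icc]; omega)]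
    ring

theorem wt_add_last (l : Fin n → ℕ) {k k' : Fin n} (h : (k' : ℕ) = k + 1) (h' : (k' : ℕ) + 1 = n) :
    wt l k + wt l k' = entry l n := by
  have h1 := wt_sub l h
  have h2 := wt_last l h'
  rw [show (k' : ℕ) = n - 1 by omega] at h1
  linarith

/-- The simple roots form a basis: the last two pairings determine the last coordinate, and the
differences determine the others going backwards. -/
theorem eq_of_pairings (hn : 2 ≤ n) {v w : E n}
    (hsub : ∀ k k' : Fin n, (k' : ℕ) = k + 1 → v k - v k' = w k - w k')
    (hadd : ∀ k k' : Fin n, (k' : ℕ) = k + 1 → (k' : ℕ) + 1 = n → v k + v k' = w k + w k') :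
    v = w := by
  have : ∀ m : ℕ, ∀ k : Fin n, (k : ℕ) + m + 1 = n → v k = w k := by
    intro m
    induction m with
    | zero =>
      intro k hk
      have h1 := hsub ⟨n - 2, by omega⟩ k (by simp; omega)
      have h2 := hadd ⟨n - 2, by omega⟩ k (by simp; omega) (by omega)
      linarith
    | succ m ih =>
      intro k hk
      have h1 := hsub k ⟨k + 1, by omega⟩ rfl
      have h2 := ih ⟨k + 1, by omega⟩ (by simp; omega)
      linarith
  ext k
  exact this (n - 1 - k) k (by omega)

theorem entry_succ {N : ℕ} (l : Fin N → ℕ) (k : Fin N) : entry l (k + 1) = l k := by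
  unfold entry
  rw [dif_pos ⟨by omega, by omega⟩]
  rfl

theorem ext_entry {N : ℕ} {l m : Fin N → ℕ} (h : ∀ i, 1 ≤ i → i ≤ N → entry l i = entry m i) :
    l = m := by
  funext k
  rw [← entry_succ l, ← entry_succ m]
  exact h _ (by omega) (by omega)

theorem wt_injective (hn : 2 ≤ n) : Function.Injective (wt : (Fin n → ℕ) → E n) := by
  intro l m h
  refine ext_entry fun i h1 h2 => ?_
  have : (entry l i : ℝ) = entry m i := by
    by_cases hi : i = n
    · have e1 := wt_add_last l (k := ⟨n - 2, by omega⟩) (k' := ⟨n - 1, by omega⟩)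
        (by simp; omega) (by simp; omega)
      have e2 := wt_add_last m (k := ⟨n - 2, by omega⟩) (k' := ⟨n - 1, by omega⟩)
        (by simp; omega) (by simp; omega)
      rw [hi, ← e1, ← e2, h]
    · have e1 := wt_sub l (k := ⟨i - 1, by omega⟩) (k' := ⟨i, by omega⟩) (by simp; omega)
      have e2 := wt_sub m (k := ⟨i - 1, by omega⟩) (k' := ⟨i, by omega⟩) (by simp; omega)
      exact e1.symm.trans ((by rw [h]) : _ = _ ) |>.trans e2
  exact_mod_cast this

/-- A dominant element of the root lattice is the weight of a monomial. -/
theorem exists_wt_eq (hn : 2 ≤ n) {v : E n} (hv : v ∈ rootLattice (rootsD n))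
    (hsub : ∀ k k' : Fin n, (k' : ℕ) = k + 1 → v k' ≤ v k)
    (hadd : ∀ k k' : Fin n, (k' : ℕ) = k + 1 → (k' : ℕ) + 1 = n → 0 ≤ v k + v k') :
    ∃ l, wt l = v := by
  choose c hc using ((mem_rootLattice_iff hn v).1 hv).1
  -- The entries of `l` must be the pairings of `v` with the simple roots: the difference starting
  -- at `i`, or the sum of the last two coordinates when `i` is last. They are integers by the
  -- lattice condition and nonnegative by dominance.
  have hex : ∀ i : Fin n, ∃ a : ℕ,
      (∀ k k' : Fin n, (k' : ℕ) = k + 1 → k = i → v k - v k' = a) ∧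
      (∀ k k' : Fin n, (k' : ℕ) = k + 1 → (k' : ℕ) + 1 = n → k' = i → v k + v k' = a) := by
    intro i
    by_cases hi : (i : ℕ) + 1 = n
    · have h : (0 : ℝ) ≤ (c ⟨n - 2, by omega⟩ : ℝ) + c i := by
        rw [← hc, ← hc]
        exact hadd ⟨n - 2, by omega⟩ i (by simp; omega) hi
      have h' : 0 ≤ c ⟨n - 2, by omega⟩ + c i := by exact_mod_cast h
      obtain ⟨a, ha⟩ := Int.eq_ofNat_of_zero_le h'
      have ha' : (c ⟨n - 2, by omega⟩ : ℝ) + c i = a := by exact_mod_cast ha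
      refine ⟨a, fun k k' hk hki => by subst hki; omega, ?_⟩
      rintro k k' hk hk' rfl
      have : k = ⟨n - 2, by omega⟩ := Fin.ext (by simp; omega)
      rw [this, hc, hc]
      exact ha'
    · have h : (c ⟨i + 1, by omega⟩ : ℝ) ≤ c i := by
        rw [← hc, ← hc]
        exact hsub i ⟨i + 1, by omega⟩ rfl
      have h' : 0 ≤ c i - c ⟨i + 1, by omega⟩ := sub_nonneg.2 (by exact_mod_cast h)
      obtain ⟨a, ha⟩ := Int.eq_ofNat_of_zero_le h'
      have ha' : (c i : ℝ) - c ⟨i + 1, by omega⟩ = a := by exact_mod_cast ha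
      refine ⟨a, ?_, fun k k' hk hk' hki => by subst hki; omega⟩
      rintro k k' hk rfl
      have : k' = ⟨k + 1, by omega⟩ := Fin.ext (by simp; omega)
      rw [this, hc, hc]
      exact ha'
  choose l hl1 hl2 using hex
  refine ⟨l, eq_of_pairings hn ?_ ?_⟩
  · intro k k' hk
    rw [wt_sub l hk, hl1 _ k k' hk rfl, hk, entry_succ]
  · intro k k' hk hk'
    rw [wt_add_last l hk hk', hl2 _ k k' hk hk' rfl]
    rw [← entry_succ l k']
    exact congrArg (fun i => (entry l i : ℝ)) hk'.symm

theorem sum_wt (hn : 2 ≤ n) (l : Fin n → ℕ) :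
    ∑ k, wt l k = ∑ j ∈ Finset.Icc 1 (n - 2), (j : ℝ) * entry l j
      + (n * (entry l (n - 1) + entry l n) / 2 - entry l (n - 1)) := by
  have h1 : ∑ k, spinPlus n k = (n : ℝ) / 2 := by
    simp only [spinPlus_apply]; simp; ring
  have h2 : ∑ k, spinMinus n k = (n : ℝ) / 2 - 1 := by
    have : ∀ k : Fin n, spinMinus n k = 1 / 2 - if k = ⟨n - 1, by omega⟩ then 1 else 0 := by
      intro k
      have hk : k = ⟨n - 1, by omega⟩ ↔ (k : ℕ) + 1 = n := by
        rw [Fin.ext_iff]; simp; omega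
      rw [spinMinus_apply]
      simp only [hk]
      split_ifs <;> norm_num
    simp only [this, Finset.sum_sub_distrib]
    simp; ring
  have h3 : ∀ j ∈ Finset.Icc 1 (n - 2), ∑ k, fundWeight n j k = j := by
    intro j hj
    rw [Finset.mem_Icc] at hj
    simp only [fundWeight_apply, Finset.sum_boole, Fin.card_filter_val_lt]
    rw [min_eq_right (by omega)]
  simp only [wt, PiLp.add_apply, PiLp.smul_apply, Finset.sum_add_distrib, WithLp.ofLp_sum,
    Finset.sum_apply, ← Finset.mul_sum, h1, h2, nsmul_eq_mul]
  rw [Finset.sum_comm]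
  have h4 : ∑ j ∈ Finset.Icc 1 (n - 2), ∑ k, (entry l j : ℝ) * fundWeight n j k
      = ∑ j ∈ Finset.Icc 1 (n - 2), (j : ℝ) * entry l j := by
    refine Finset.sum_congr rfl fun j hj => ?_
    rw [← Finset.mul_sum, h3 j hj, mul_comm]
  rw [h4]
  ring

theorem mem_M_iff {l : Fin n → ℕ} : l ∈ M n ↔ Even (entry l (n - 1) + entry l n) ∧
    Even ((entry l (n - 1) + entry l n) / 2 * n + entry l (n - 1)
      + ∑ i ∈ Finset.Icc 1 (n - 2) with Odd i, entry l i) := Iff.rfl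

/-- Reduces the coordinate sum of `wt l`, which contains `∑ j l_j`, modulo 2 to the odd-position sum
in the definition of `M n`. -/
theorem even_sum_add_sum_odd (s : Finset ℕ) (f : ℕ → ℕ) :
    Even (∑ j ∈ s, j * f j + ∑ j ∈ s with Odd j, f j) := by
  rw [Finset.sum_filter, ← Finset.sum_add_distrib]
  refine Finset.even_sum _ fun j _ => ?_
  split_ifs with h
  · rw [← Nat.succ_mul]
    exact (h.add_one).mul_right _
  · exact ((Nat.not_odd_iff_even.1 h).mul_right _).add Even.zero

/-- Integrality of the last coordinate `(l_n - l_(n-1)) / 2` is the first parity condition and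
implies integrality of all the others. Evenness of the coordinate sum is the second. -/
theorem wt_mem_iff (hn : 2 ≤ n) (l : Fin n → ℕ) : wt l ∈ rootLattice (rootsD n) ↔ l ∈ M n := by
  rw [mem_rootLattice_iff hn, mem_M_iff, sum_wt hn]
  have hpar := even_sum_add_sum_odd (Finset.Icc 1 (n - 2)) (entry l)
  have hcast : ∑ j ∈ Finset.Icc 1 (n - 2), (j : ℝ) * entry l j
      = ((∑ j ∈ Finset.Icc 1 (n - 2), j * entry l j : ℕ) : ℝ) := by push_cast; rfl
  rw [hcast]
  set S := ∑ j ∈ Finset.Icc 1 (n - 2), j * entry l j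
  set O := ∑ j ∈ Finset.Icc 1 (n - 2) with Odd j, entry l j
  set a := entry l (n - 1) with ha
  set b := entry l n with hb
  have main : ∀ c : ℕ, a + b = 2 * c →
      ((∃ z : ℤ, (S : ℝ) + (n * (a + b) / 2 - a) = 2 * z) ↔ Even ((a + b) / 2 * n + a + O)) := by
    intro c hc
    have hc' : (a : ℝ) + b = 2 * c := by exact_mod_cast hc
    have e1 : (S : ℝ) + (n * (a + b) / 2 - a) = ((S + c * n - a : ℤ) : ℝ) := by
      rw [hc']; push_cast; ring
    rw [hc, Nat.mul_div_cancel_left _ (by norm_num), e1]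
    have e2 : (∃ z : ℤ, ((S + c * n - a : ℤ) : ℝ) = 2 * z) ↔ ∃ z : ℤ, (S + c * n - a : ℤ) = 2 * z :=
      exists_congr fun z => by norm_cast
    rw [e2]
    have hcn : ((c : ℤ) * n) = ((c * n : ℕ) : ℤ) := by push_cast; rfl
    rw [hcn]
    generalize c * n = q
    constructor
    · rintro ⟨z, hz⟩
      obtain ⟨y, hy⟩ := hpar
      rw [Nat.even_iff]; omega
    · rintro ⟨x, hx⟩
      obtain ⟨y, hy⟩ := hpar
      exact ⟨(S + q - a) / 2, by omega⟩
  constructor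
  · rintro ⟨h1, h2⟩
    obtain ⟨z, hz⟩ := h1 ⟨n - 1, by omega⟩
    rw [wt_last l (by simp; omega), ← ha, ← hb] at hz
    have hz' : (b : ℤ) - a = 2 * z := by
      have : (b : ℝ) - a = 2 * z := by linarith
      exact_mod_cast this
    have hab : a + b = 2 * ((a + b) / 2) := by omega
    exact ⟨⟨(a + b) / 2, by omega⟩, (main _ hab).1 h2⟩
  · rintro ⟨⟨c, hc⟩, h2⟩
    refine ⟨fun k => ?_, (main c (by omega)).2 h2⟩
    have hc' : (a : ℝ) + b = 2 * c := by rw [two_mul]; exact_mod_cast hc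
    refine ⟨∑ j ∈ Finset.Icc 1 (n - 2), (if (k : ℕ) < j then (entry l j : ℤ) else 0)
      + c - (if (k : ℕ) + 1 = n then a else 0), ?_⟩
    rw [wt_apply]
    push_cast
    split_ifs <;> linarith

/-! ### Well-foundedness of the lexicographic order on dominant weights -/

/-- A tuple of natural numbers that increases with `wt l` for the lexicographic order. -/
def wtRank (l : Fin n → ℕ) : Lex (Fin n → ℕ) := toLex fun k =>
  if (k : ℕ) + 1 = n then entry l n else
    2 * ∑ j ∈ Finset.Icc 1 (n - 2), (if (k : ℕ) < j then entry l j else 0)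
      + entry l (n - 1) + entry l n

/-- Coordinates of `wt l` are half-integers and the last may be negative. Doubling the others and
replacing the last by the sum of the last two, which is `l_n`, gives natural numbers. Where the
earlier coordinates agree, that sum compares as the last coordinate does. -/
theorem wtRank_lt (hn : 2 ≤ n) {l m : Fin n → ℕ} (h : lx (wt l) < lx (wt m)) :
    wtRank l < wtRank m := by
  have h1 : ∀ (l : Fin n → ℕ) (k : Fin n), (k : ℕ) + 1 ≠ n → ((wtRank l k : ℕ) : ℝ) = 2 * wt l k := by
    intro l k hk
    rw [wt_apply]
    simp only [wtRank, Pi.toLex_apply, if_neg hk]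
    push_cast
    ring
  have h2 : ∀ (l : Fin n → ℕ) (k k' : Fin n), (k' : ℕ) = k + 1 → (k' : ℕ) + 1 = n →
      ((wtRank l k' : ℕ) : ℝ) = wt l k + wt l k' := by
    intro l k k' hk hk'
    rw [wt_add_last l hk hk']
    simp only [wtRank, Pi.toLex_apply, if_pos hk']
  obtain ⟨i, hlt, hi⟩ := lx_lt_iff.1 h
  refine ⟨i, fun j hj => ?_, ?_⟩
  · have hj' : (j : ℕ) + 1 ≠ n := by have : (j : ℕ) < i := hj; omega
    have : ((wtRank l j : ℕ) : ℝ) = (wtRank m j : ℕ) := by rw [h1 l j hj', h1 m j hj', hlt j hj]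
    exact_mod_cast this
  · have : ((wtRank l i : ℕ) : ℝ) < (wtRank m i : ℕ) := by
      by_cases hi' : (i : ℕ) + 1 = n
      · have hk : ((⟨n - 2, by omega⟩ : Fin n) : ℕ) + 1 = i := by simp; omega
        rw [h2 l ⟨n - 2, by omega⟩ i hk.symm hi', h2 m ⟨n - 2, by omega⟩ i hk.symm hi',
          hlt _ (Fin.lt_def.2 (by omega))]
        linarith
      · rw [h1 l i hi', h1 m i hi']
        linarith
    exact_mod_cast this

/-! ### The basis of monomials -/

theorem mono_zero : mono (0 : Fin n → ℕ) = 1 := by simp [mono, entry_zero]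

theorem mono_add (l m : Fin n → ℕ) : mono (l + m) = mono l * mono m := by
  simp only [mono, entry_add, pow_add, Finset.prod_mul_distrib]
  ring

/-- In a nontrivial relation the term with the largest `wt l` contributes the only nonzero
coefficient at that exponent. -/
theorem linearIndependent_mono (hn : 2 ≤ n) :
    LinearIndependent ℤ (mono : (Fin n → ℕ) → GroupRing n) := by
  rw [linearIndependent_iff]
  intro c hc
  by_contra hne
  obtain ⟨l, hl, hmax⟩ := Finset.exists_max_image c.support (fun l => lx (wt l))
    (Finsupp.support_nonempty_iff.2 hne)
  have h := congrArg (fun f : GroupRing n => f.coeff (wt l)) hc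
  simp only [Finsupp.linearCombination_apply, Finsupp.sum, AddMonoidAlgebra.coeff_sum,
    Finsupp.finsetSum_apply, AddMonoidAlgebra.coeff_smul, Finsupp.smul_apply,
    AddMonoidAlgebra.coeff_zero, Finsupp.zero_apply] at h
  rw [Finset.sum_eq_single_of_mem l hl, (isLead_mono hn l).coeff_self] at h
  · exact Finsupp.mem_support_iff.1 hl (by simpa using h)
  · intro m hm hml
    rw [smul_eq_zero]
    right
    by_contra hcm
    exact hml (wt_injective hn (lx_injective
      (le_antisymm (hmax m hm) ((isLead_mono hn m).le _ hcm))))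

theorem mono_injective (hn : 2 ≤ n) : Function.Injective (mono : (Fin n → ℕ) → GroupRing n) :=
  (linearIndependent_mono hn).injective

theorem mono_mem_invariants (hn : 2 ≤ n) {l : Fin n → ℕ} (hl : l ∈ M n) :
    mono l ∈ invariants (rootsD n) := by
  rw [mem_invariants_iff]
  constructor
  · intro v hv
    have := add_mem ((isLead_mono hn l).sub_mem v hv) ((wt_mem_iff hn l).2 hl)
    rwa [sub_add_cancel] at this
  · intro i j s t hij
    simp only [mono, map_mul, map_prod, map_pow, act_reflD_sigma hij.ne, act_reflD_tau hij.ne]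

/-- By invariance, the reflections of the leading exponent `v` are exponents of `f` as well and so
do not exceed `v`. This makes `v` dominant. -/
theorem exists_leading_wt (hn : 2 ≤ n) {f : GroupRing n} (hf : f ∈ invariants (rootsD n))
    (h0 : f ≠ 0) : ∃ l ∈ M n, f.coeff (wt l) ≠ 0 ∧ ∀ u, f.coeff u ≠ 0 → lx u ≤ lx (wt l) := by
  obtain ⟨v, hv, hmax⟩ := Finset.exists_max_image f.coeff.support lx
    (Finsupp.support_nonempty_iff.2 (by simpa using h0))
  simp only [Finsupp.mem_support_iff] at hv hmax
  rw [mem_invariants_iff] at hf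
  have hle : ∀ i j s t, i < j → lx (reflD i j s t v) ≤ lx v := by
    intro i j s t hij
    apply hmax
    rw [← hf.2 i j s t hij, coeff_act]
    exact hv
  -- The reflection keeps the coordinates before `i` and puts `-(s t) v_j` at `i`, so the
  -- lexicographic comparison is decided there unless the two values agree.
  have hdom : ∀ i j s t, i < j → ((-(s * t) : ℤˣ) : ℤ) * v j ≤ v i := by
    intro i j s t hij
    by_contra! hlt
    refine absurd (hle i j s t hij) (not_le.2 (lx_lt_iff.2 ⟨i, fun k hk => ?_, ?_⟩))
    · rw [reflD_apply hij.ne, if_neg (by rintro (rfl | rfl); exacts [lt_irrefl _ hk, lt_asymm hk hij]),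
        Equiv.swap_apply_of_ne_of_ne hk.ne (hk.trans hij).ne]
      simp
    · rw [reflD_apply hij.ne, if_pos (Or.inl rfl), Equiv.swap_apply_left]
      exact hlt
  obtain ⟨l, rfl⟩ := exists_wt_eq hn (hf.1 v hv)
    (fun k k' hk => by simpa using hdom k k' 1 (-1) (Fin.lt_def.2 (by omega)))
    (fun k k' hk _ => by
      have := hdom k k' 1 1 (Fin.lt_def.2 (by omega))
      simp at this
      linarith)
  exact ⟨l, (wt_mem_iff hn l).1 (hf.1 _ hv), hv, hmax⟩

/-- Division by leading terms: since `mono l` has leading coefficient one, the top term can be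
cancelled over `ℤ`. Termination is the well-founded order on `wtRank`. -/
theorem mem_span_mono (hn : 2 ≤ n) {f : GroupRing n} (hf : f ∈ invariants (rootsD n)) :
    f ∈ Submodule.span ℤ (mono '' (M n : Set (Fin n → ℕ))) := by
  by_cases h0 : f = 0
  · rw [h0]; exact zero_mem _
  obtain ⟨l, hl, hne, hmax⟩ := exists_leading_wt hn hf h0
  induction hr : wtRank l using WellFoundedLT.induction generalizing l f with
  | _ r ih =>
  have hm := isLead_mono hn l
  have hmem : f.coeff (wt l) • mono l ∈ Submodule.span ℤ (mono '' (M n : Set (Fin n → ℕ))) :=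
    Submodule.smul_mem _ _ (Submodule.subset_span ⟨l, hl, rfl⟩)
  have hg : f - f.coeff (wt l) • mono l ∈ invariants (rootsD n) :=
    sub_mem hf (Subalgebra.smul_mem _ (mono_mem_invariants hn hl) _)
  rw [← sub_add_cancel f (f.coeff (wt l) • mono l)]
  refine add_mem ?_ hmem
  by_cases hg0 : f - f.coeff (wt l) • mono l = 0
  · rw [hg0]; exact zero_mem _
  obtain ⟨m, hmM, hne', hmax'⟩ := exists_leading_wt hn hg hg0
  refine ih (wtRank m) ?_ hg hg0 m hmM hne' hmax' rfl
  rw [← hr]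
  apply wtRank_lt hn
  -- Neither `f` nor `mono l` has an exponent above `wt l`, and the coefficient at `wt l` itself
  -- cancels.
  apply lt_of_le_of_ne
  · by_contra hlt
    apply hne'
    have h1 : f.coeff (wt m) = 0 := by
      by_contra h; exact hlt (hmax _ h)
    have h2 : (mono l).coeff (wt m) = 0 := by
      by_contra h; exact hlt (hm.le _ h)
    rw [AddMonoidAlgebra.coeff_sub, Finsupp.sub_apply, AddMonoidAlgebra.coeff_smul,
      Finsupp.smul_apply, h1, h2, smul_zero, sub_zero]
  · intro heq
    apply hne'
    rw [lx_injective heq, AddMonoidAlgebra.coeff_sub, Finsupp.sub_apply,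
      AddMonoidAlgebra.coeff_smul, Finsupp.smul_apply, hm.coeff_self, smul_eq_mul, mul_one, sub_self]

/-! ### The isomorphism of the monoid algebra with the algebra of invariants -/

/-- The monomials with exponents in `M n`, as a homomorphism to the algebra of invariants. -/
noncomputable def monoHom (hn : 2 ≤ n) : Multiplicative (M n) →* invariants (rootsD n) where
  toFun l := ⟨mono (l.toAdd : Fin n → ℕ), mono_mem_invariants hn l.toAdd.2⟩
  map_one' := Subtype.ext mono_zero
  map_mul' _ _ := Subtype.ext (mono_add _ _)

theorem coe_lift_monoHom (hn : 2 ≤ n) (f : AddMonoidAlgebra ℤ (M n)) :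
    (AddMonoidAlgebra.lift ℤ _ (M n) (monoHom hn) f : GroupRing n)
      = Finsupp.linearCombination ℤ (fun l : M n => mono (l : Fin n → ℕ)) f.coeff := by
  rw [AddMonoidAlgebra.lift_apply, Finsupp.linearCombination_apply, Finsupp.sum, Finsupp.sum]
  simp [monoHom]

theorem bijective_lift_monoHom (hn : 2 ≤ n) :
    Function.Bijective (AddMonoidAlgebra.lift ℤ _ (M n) (monoHom hn)) := by
  constructor
  · intro f g h
    have h' := congrArg (Subtype.val) h
    rw [coe_lift_monoHom, coe_lift_monoHom] at h'
    exact AddMonoidAlgebra.coeff_injective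
      (((linearIndependent_mono hn).comp _ Subtype.val_injective) h')
  · rintro ⟨f, hf⟩
    have h := mem_span_mono hn hf
    rw [← Subtype.range_coe (s := (M n : Set (Fin n → ℕ))), ← Set.range_comp,
      Finsupp.mem_span_range_iff_exists_finsupp] at h
    obtain ⟨c, hc⟩ := h
    refine ⟨AddMonoidAlgebra.ofCoeff c, Subtype.ext ?_⟩
    rw [coe_lift_monoHom]
    exact hc

/-! ### The decomposition of `M n` -/

theorem entry_mk {N : ℕ} (f : ℕ → ℕ) {i : ℕ} (h1 : 1 ≤ i) (h2 : i ≤ N) :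
    entry (fun k : Fin N => f (k + 1)) i = f i := by
  unfold entry
  rw [dif_pos ⟨h1, h2⟩]
  exact congrArg f (by simp; omega)

/-- The conditions of `M n` ignore the even positions `≤ n - 2`. The remaining entries are listed as
`l_n, l_(n-1), l_1, l_3, …`, so position `j ≥ 3` holds `l_(2j-5)`, and the sum over `i ≥ 2` collects
`l_(n-1)` and the odd entries. -/
theorem mem_M_iff_mem_W (hn : 4 ≤ n) {l : Fin n → ℕ} {k : Fin ((n + 3) / 2) → ℕ}
    (h1 : entry k 1 = entry l n) (h2 : entry k 2 = entry l (n - 1))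
    (h3 : ∀ j, 3 ≤ j → j ≤ (n + 3) / 2 → entry k j = entry l (2 * j - 5)) :
    l ∈ M n ↔ k ∈ W n := by
  have hs : ∑ i ∈ Finset.Icc 1 (n - 2) with Odd i, entry l i
      = ∑ j ∈ Finset.Icc 3 ((n + 3) / 2), entry k j := by
    refine Finset.sum_nbij' (fun i => (i + 5) / 2) (fun j => 2 * j - 5) ?_ ?_ ?_ ?_ ?_
    · intro i hi
      simp only [Finset.mem_filter, Finset.mem_Icc, Nat.odd_iff] at hi ⊢
      omega
    · intro j hj
      simp only [Finset.mem_filter, Finset.mem_Icc, Nat.odd_iff] at hj ⊢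
      omega
    · intro i hi
      simp only [Finset.mem_filter, Finset.mem_Icc, Nat.odd_iff] at hi ⊢
      omega
    · intro j hj
      simp only [Finset.mem_Icc] at hj ⊢
      omega
    · intro i hi
      simp only [Finset.mem_filter, Finset.mem_Icc, Nat.odd_iff] at hi
      rw [h3 _ (by omega) (by omega)]
      congr 1
      omega
  have ht : ∑ i ∈ Finset.Icc 2 ((n + 3) / 2), entry k i
      = entry k 2 + ∑ j ∈ Finset.Icc 3 ((n + 3) / 2), entry k j := by
    rw [← Finset.sum_insert (by simp)]
    congr 1
    ext i
    simp only [Finset.mem_insert, Finset.mem_Icc]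
    omega
  change _ ↔ Even (entry k 1 + entry k 2) ∧
    Even ((entry k 1 + entry k 2) / 2 * n + ∑ i ∈ Finset.Icc 2 ((n + 3) / 2), entry k i)
  rw [mem_M_iff, ht, hs, h1, h2, add_comm (entry l n), add_assoc]

/-- The position in a tuple of `M n` of the `j`-th entry of a tuple of `W n`. -/
def wIndex (n j : ℕ) : ℕ := if j = 1 then n else if j = 2 then n - 1 else 2 * j - 5

/-- The entries of the tuple of `M n` that is composed of its entries at even positions `≤ n - 2`
and of a tuple of `W n`. -/
def joinEntry (p : Fin ((n - 2) / 2) → ℕ) (k : Fin ((n + 3) / 2) → ℕ) (i : ℕ) : ℕ :=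
  if i = n then entry k 1 else if i = n - 1 then entry k 2
    else if i % 2 = 1 then entry k ((i + 5) / 2) else entry p (i / 2)

/-- The part of a tuple of `M n` outside the even positions `≤ n - 2`. -/
def wPart (l : Fin n → ℕ) : Fin ((n + 3) / 2) → ℕ := fun j => entry l (wIndex n (j + 1))

theorem entry_wPart (l : Fin n → ℕ) {j : ℕ} (h1 : 1 ≤ j) (h2 : j ≤ (n + 3) / 2) :
    entry (wPart l) j = entry l (wIndex n j) :=
  entry_mk (fun j => entry l (wIndex n j)) h1 h2

theorem wPart_mem_iff (hn : 4 ≤ n) {l : Fin n → ℕ} : l ∈ M n ↔ wPart l ∈ W n := by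
  refine mem_M_iff_mem_W hn ?_ ?_ fun j h1 h2 => ?_
  · rw [entry_wPart l le_rfl (by omega)]; rfl
  · rw [entry_wPart l (by omega) (by omega)]; rfl
  · rw [entry_wPart l (by omega) h2, wIndex, if_neg (by omega), if_neg (by omega)]

theorem wPart_join (hn : 4 ≤ n) (p : Fin ((n - 2) / 2) → ℕ) (k : Fin ((n + 3) / 2) → ℕ) :
    wPart (fun i : Fin n => joinEntry p k (i + 1)) = k := by
  refine ext_entry fun j h1 h2 => ?_
  rw [entry_wPart _ h1 h2, entry_mk _ (by unfold wIndex; split_ifs <;> omega)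
    (by unfold wIndex; split_ifs <;> omega)]
  unfold wIndex joinEntry
  split_ifs <;> first | omega | (congr 1; omega)

theorem M_decomposition (hn : 4 ≤ n) : Nonempty (M n ≃+ (Fin ((n - 2) / 2) → ℕ) × W n) :=
  ⟨{ toFun := fun l => (fun m => entry (l : Fin n → ℕ) (2 * (m + 1)),
        ⟨wPart (l : Fin n → ℕ), (wPart_mem_iff hn).1 l.2⟩)
     invFun := fun x => ⟨fun i => joinEntry x.1 (x.2 : Fin ((n + 3) / 2) → ℕ) (i + 1), by
        rw [wPart_mem_iff hn, wPart_join hn]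
        exact x.2.2⟩
     left_inv := by
        intro l
        refine Subtype.ext (ext_entry fun i h1 h2 => ?_)
        rw [entry_mk _ h1 h2]
        change joinEntry (fun m => entry (l : Fin n → ℕ) (2 * (m + 1))) (wPart (l : Fin n → ℕ)) i = _
        unfold joinEntry
        split_ifs with h3 h4 h5
        · rw [entry_wPart _ (by omega) (by omega), h3]; rfl
        · rw [entry_wPart _ (by omega) (by omega), h4]; rfl
        · rw [entry_wPart _ (by omega) (by omega), wIndex, if_neg (by omega), if_neg (by omega)]
          congr 1; omega
        · rw [entry_mk (fun m => entry (l : Fin n → ℕ) (2 * m)) (by omega) (by omega)]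
          congr 1; omega
     right_inv := by
        rintro ⟨p, k⟩
        refine Prod.ext ?_ (Subtype.ext (wPart_join hn _ _))
        refine ext_entry fun i h1 h2 => ?_
        rw [entry_mk (fun m => entry _ (2 * m)) h1 h2, entry_mk _ (by omega) (by omega)]
        unfold joinEntry
        rw [if_neg (by omega), if_neg (by omega), if_neg (by omega)]
        congr 1; omega
     map_add' := by
        intro l m
        refine Prod.ext ?_ (Subtype.ext ?_)
        · funext i; exact entry_add _ _ _
        · funext i; exact entry_add _ _ _ }⟩

/-! ### Sums of entries over the odd and the even positions -/

/-- The sum of the entries at odd positions `≤ n - 2`. -/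
def oddSum (l : Fin n → ℕ) : ℕ := ∑ i ∈ Finset.Icc 1 (n - 2) with Odd i, entry l i

/-- The sum of the entries at even positions `≤ n - 2`. -/
def evenSum (l : Fin n → ℕ) : ℕ := ∑ i ∈ Finset.Icc 1 (n - 2) with ¬ Odd i, entry l i

theorem oddSum_add (l m : Fin n → ℕ) : oddSum (l + m) = oddSum l + oddSum m := by
  simp [oddSum, entry_add, Finset.sum_add_distrib]

theorem evenSum_add (l m : Fin n → ℕ) : evenSum (l + m) = evenSum l + evenSum m := by
  simp [evenSum, entry_add, Finset.sum_add_distrib]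

theorem mem_M_iff_even (h : Even n) {l : Fin n → ℕ} :
    l ∈ M n ↔ (entry l (n - 1) + entry l n) % 2 = 0 ∧ (entry l (n - 1) + oddSum l) % 2 = 0 := by
  rw [mem_M_iff, Nat.even_iff, add_assoc, Nat.even_add]
  simp only [h.mul_left, true_iff]
  rw [Nat.even_iff]
  rfl

theorem mem_M_iff_odd (h : Odd n) {l : Fin n → ℕ} :
    l ∈ M n ↔ (entry l (n - 1) + entry l n) % 2 = 0 ∧
      ((entry l (n - 1) + entry l n) / 2 + entry l (n - 1) + oddSum l) % 2 = 0 := by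
  rw [mem_M_iff, Nat.even_iff, add_assoc, add_assoc, Nat.even_add, Nat.even_mul]
  simp only [Nat.not_even_iff_odd.2 h, or_false]
  rw [← Nat.even_add, Nat.even_iff]
  rfl

theorem eq_zero_of_sums {l : Fin n → ℕ} (h1 : oddSum l = 0) (h2 : evenSum l = 0)
    (h3 : entry l (n - 1) = 0) (h4 : entry l n = 0) : l = 0 := by
  refine ext_entry fun i hi1 hi2 => ?_
  rw [entry_zero]
  by_cases hi : i ≤ n - 2
  · by_cases ho : Odd i
    · exact Finset.sum_eq_zero_iff.1 h1 i (by simp [hi1, hi, ho])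
    · exact Finset.sum_eq_zero_iff.1 h2 i
        (by simp only [Finset.mem_filter, Finset.mem_Icc]; exact ⟨⟨hi1, hi⟩, ho⟩)
  · rcases (by omega : i = n - 1 ∨ i = n) with rfl | rfl
    · exact h3
    · exact h4

theorem exists_le_sum_eq (s : Finset ℕ) (f : ℕ → ℕ) {m : ℕ} (hm : m ≤ ∑ i ∈ s, f i) :
    ∃ g : ℕ → ℕ, (∀ i, g i ≤ f i) ∧ ∑ i ∈ s, g i = m := by
  induction m with
  | zero => exact ⟨0, by simp, by simp⟩
  | succ m ih =>
    obtain ⟨g, hg, hgm⟩ := ih (by omega)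
    obtain ⟨i, hi, hlt⟩ := Finset.exists_lt_of_sum_lt (show ∑ i ∈ s, g i < ∑ i ∈ s, f i by omega)
    refine ⟨Function.update g i (g i + 1), fun j => ?_, ?_⟩
    · by_cases hj : j = i
      · subst hj; simp; omega
      · simp [hj, hg j]
    · rw [Finset.sum_update_of_mem hi, ← hgm, Finset.sum_eq_add_sum_sdiff_singleton_of_mem hi g]
      omega

/-- Every vector of sums below the one of `l` belongs to a summand of `l`. -/
theorem exists_add_eq (hn : 4 ≤ n) (l : Fin n → ℕ) {o v a b : ℕ} (ho : o ≤ oddSum l)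
    (hv : v ≤ evenSum l) (ha : a ≤ entry l (n - 1)) (hb : b ≤ entry l n) :
    ∃ l' l'', l = l' + l'' ∧ oddSum l' = o ∧ evenSum l' = v ∧ entry l' (n - 1) = a ∧
      entry l' n = b := by
  obtain ⟨g, hg, hgo⟩ := exists_le_sum_eq _ _ ho
  obtain ⟨g', hg', hgv⟩ := exists_le_sum_eq _ _ hv
  let F : ℕ → ℕ := fun i => if i = n then b else if i = n - 1 then a else
    if Odd i then g i else g' i
  have hF : ∀ i, 1 ≤ i → i ≤ n → entry (fun k : Fin n => F (k + 1)) i = F i :=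
    fun i h1 h2 => entry_mk F h1 h2
  refine ⟨fun k => F (k + 1), fun k => l k - F (k + 1), ?_, ?_, ?_, ?_, ?_⟩
  · funext k
    have : F (k + 1) ≤ l k := by
      rw [← entry_succ l]
      simp only [F]
      split_ifs with h1 h2 h3
      · rw [h1]; exact hb
      · rw [h2]; exact ha
      · exact hg _
      · exact hg' _
    simp only [Pi.add_apply]
    omega
  · rw [← hgo]
    refine Finset.sum_congr rfl fun i hi => ?_
    simp only [Finset.mem_filter, Finset.mem_Icc] at hi
    rw [hF i (by omega) (by omega)]
    simp only [F]
    rw [if_neg (by omega), if_neg (by omega), if_pos hi.2]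
  · rw [← hgv]
    refine Finset.sum_congr rfl fun i hi => ?_
    simp only [Finset.mem_filter, Finset.mem_Icc] at hi
    rw [hF i (by omega) (by omega)]
    simp only [F]
    rw [if_neg (by omega), if_neg (by omega), if_neg hi.2]
  · rw [hF _ (by omega) (by omega)]
    change (if n - 1 = n then _ else _) = _
    rw [if_neg (by omega), if_pos rfl]
  · rw [hF _ (by omega) (by omega)]
    exact if_pos rfl

/-- The tuples with given sums of entries. -/
def fiber (n o v a b : ℕ) : Set (Fin n → ℕ) :=
  {l | oddSum l = o ∧ evenSum l = v ∧ entry l (n - 1) = a ∧ entry l n = b}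

theorem oddSum_zero : oddSum (0 : Fin n → ℕ) = 0 := by simp [oddSum, entry_zero]

theorem evenSum_zero : evenSum (0 : Fin n → ℕ) = 0 := by simp [evenSum, entry_zero]

/-- Indecomposability in `M n` depends on the sums of the entries only. -/
theorem mem_hilbertBasis_iff (hn : 4 ≤ n) {P : ℕ → ℕ → ℕ → Prop}
    (hP : ∀ l : Fin n → ℕ, l ∈ M n ↔ P (oddSum l) (entry l (n - 1)) (entry l n)) (l : Fin n → ℕ) :
    l ∈ hilbertBasis (M n) ↔ P (oddSum l) (entry l (n - 1)) (entry l n) ∧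
      ¬ (oddSum l = 0 ∧ evenSum l = 0 ∧ entry l (n - 1) = 0 ∧ entry l n = 0) ∧
      ∀ o v a b, o ≤ oddSum l → v ≤ evenSum l → a ≤ entry l (n - 1) → b ≤ entry l n → P o a b →
        P (oddSum l - o) (entry l (n - 1) - a) (entry l n - b) →
        (o = 0 ∧ v = 0 ∧ a = 0 ∧ b = 0) ∨
          (oddSum l = o ∧ evenSum l = v ∧ entry l (n - 1) = a ∧ entry l n = b) := by
  constructor
  · intro hl
    refine ⟨(hP l).1 hl.1, fun hz => hl.2.1 (eq_zero_of_sums hz.1 hz.2.1 hz.2.2.1 hz.2.2.2), ?_⟩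
    intro o v a b ho hv ha hb h1 h2
    -- A numerical splitting lifts to a splitting of tuples, to which indecomposability of `l`
    -- applies.
    obtain ⟨l', l'', hadd, rfl, rfl, rfl, rfl⟩ := exists_add_eq hn l ho hv ha hb
    subst hadd
    simp only [oddSum_add, evenSum_add, entry_add, Nat.add_sub_cancel_left] at h2 ⊢
    rcases hl.2.2 l' ((hP _).2 h1) l'' ((hP _).2 h2) rfl with h | h
    · left; simp [h, oddSum_zero, evenSum_zero, entry_zero]
    · right; simp [h, oddSum_zero, evenSum_zero, entry_zero]
  · rintro ⟨h1, h2, h3⟩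
    refine ⟨(hP l).2 h1, ?_, ?_⟩
    · rintro rfl
      exact h2 ⟨oddSum_zero, evenSum_zero, entry_zero _, entry_zero _⟩
    · rintro a ha b hb rfl
      have := h3 (oddSum a) (evenSum a) (entry a (n - 1)) (entry a n)
      simp only [oddSum_add, evenSum_add, entry_add, Nat.add_sub_cancel_left, le_add_iff_nonneg_right,
        zero_le, true_imp_iff, Nat.add_eq_left] at this
      rcases this ((hP a).1 ha) ((hP b).1 hb) with hz | hz
      · exact Or.inl (eq_zero_of_sums hz.1 hz.2.1 hz.2.2.1 hz.2.2.2)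
      · exact Or.inr (eq_zero_of_sums hz.1 hz.2.1 hz.2.2.1 hz.2.2.2)

/-- Each of the first four vectors can be split off as soon as it fits below `(O, V, A, B)`. If none
fits, then `V = 0` and `O, A, B ≤ 1`, and parity makes `O, A, B` equal, hence all `1`. -/
theorem indecomposable_iff_even (O V A B : ℕ) :
    (((A + B) % 2 = 0 ∧ (A + O) % 2 = 0) ∧ ¬ (O = 0 ∧ V = 0 ∧ A = 0 ∧ B = 0) ∧
      ∀ o v a b, o ≤ O → v ≤ V → a ≤ A → b ≤ B → ((a + b) % 2 = 0 ∧ (a + o) % 2 = 0) →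
        ((A - a + (B - b)) % 2 = 0 ∧ (A - a + (O - o)) % 2 = 0) →
        (o = 0 ∧ v = 0 ∧ a = 0 ∧ b = 0) ∨ (O = o ∧ V = v ∧ A = a ∧ B = b)) ↔
    (O = 0 ∧ V = 1 ∧ A = 0 ∧ B = 0) ∨ (O = 2 ∧ V = 0 ∧ A = 0 ∧ B = 0) ∨
      (O = 0 ∧ V = 0 ∧ A = 2 ∧ B = 0) ∨ (O = 0 ∧ V = 0 ∧ A = 0 ∧ B = 2) ∨
      (O = 1 ∧ V = 0 ∧ A = 1 ∧ B = 1) := by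
  constructor
  · rintro ⟨hP, hne, key⟩
    by_cases c1 : 1 ≤ V
    · have := key 0 1 0 0 (by omega) c1 (by omega) (by omega) (by omega) (by omega)
      exact Or.inl (this.resolve_left (by omega))
    by_cases c2 : 2 ≤ O
    · have := key 2 0 0 0 c2 (by omega) (by omega) (by omega) (by omega) (by omega)
      exact Or.inr (Or.inl (this.resolve_left (by omega)))
    by_cases c3 : 2 ≤ A
    · have := key 0 0 2 0 (by omega) (by omega) c3 (by omega) (by omega) (by omega)
      exact Or.inr (Or.inr (Or.inl (this.resolve_left (by omega))))
    by_cases c4 : 2 ≤ B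
    · have := key 0 0 0 2 (by omega) (by omega) (by omega) c4 (by omega) (by omega)
      exact Or.inr (Or.inr (Or.inr (Or.inl (this.resolve_left (by omega)))))
    clear key
    exact Or.inr (Or.inr (Or.inr (Or.inr (by omega))))
  · rintro (⟨rfl, rfl, rfl, rfl⟩ | ⟨rfl, rfl, rfl, rfl⟩ | ⟨rfl, rfl, rfl, rfl⟩ |
      ⟨rfl, rfl, rfl, rfl⟩ | ⟨rfl, rfl, rfl, rfl⟩) <;>
    refine ⟨by omega, by omega, fun o v a b ho hv ha hb h1 h2 => ?_⟩ <;> omega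

theorem indecomposable_iff_odd (O V A B : ℕ) :
    (((A + B) % 2 = 0 ∧ ((A + B) / 2 + A + O) % 2 = 0) ∧ ¬ (O = 0 ∧ V = 0 ∧ A = 0 ∧ B = 0) ∧
      ∀ o v a b, o ≤ O → v ≤ V → a ≤ A → b ≤ B →
        ((a + b) % 2 = 0 ∧ ((a + b) / 2 + a + o) % 2 = 0) →
        ((A - a + (B - b)) % 2 = 0 ∧ ((A - a + (B - b)) / 2 + (A - a) + (O - o)) % 2 = 0) →
        (o = 0 ∧ v = 0 ∧ a = 0 ∧ b = 0) ∨ (O = o ∧ V = v ∧ A = a ∧ B = b)) ↔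
    (O = 0 ∧ V = 1 ∧ A = 0 ∧ B = 0) ∨ (O = 2 ∧ V = 0 ∧ A = 0 ∧ B = 0) ∨
      (O = 0 ∧ V = 0 ∧ A = 4 ∧ B = 0) ∨ (O = 0 ∧ V = 0 ∧ A = 0 ∧ B = 4) ∨
      (O = 0 ∧ V = 0 ∧ A = 1 ∧ B = 1) ∨ (O = 1 ∧ V = 0 ∧ A = 2 ∧ B = 0) ∨
      (O = 1 ∧ V = 0 ∧ A = 0 ∧ B = 2) := by
  constructor
  · rintro ⟨hP, hne, key⟩
    by_cases c1 : 1 ≤ V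
    · have := key 0 1 0 0 (by omega) c1 (by omega) (by omega) (by omega) (by omega)
      exact Or.inl (this.resolve_left (by omega))
    by_cases c2 : 2 ≤ O
    · have := key 2 0 0 0 c2 (by omega) (by omega) (by omega) (by omega) (by omega)
      exact Or.inr (Or.inl (this.resolve_left (by omega)))
    by_cases c3 : 1 ≤ A ∧ 1 ≤ B
    · have := key 0 0 1 1 (by omega) (by omega) c3.1 c3.2 (by omega) (by omega)
      exact Or.inr (Or.inr (Or.inr (Or.inr (Or.inl (this.resolve_left (by omega))))))
    by_cases c4 : 4 ≤ A
    · have := key 0 0 4 0 (by omega) (by omega) c4 (by omega) (by omega) (by omega)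
      exact Or.inr (Or.inr (Or.inl (this.resolve_left (by omega))))
    by_cases c5 : 4 ≤ B
    · have := key 0 0 0 4 (by omega) (by omega) (by omega) c5 (by omega) (by omega)
      exact Or.inr (Or.inr (Or.inr (Or.inl (this.resolve_left (by omega)))))
    clear key
    iterate 5 right
    rcases (by omega : A = 0 ∨ B = 0) with rfl | rfl
    · right; omega
    · left; omega
  · rintro (⟨rfl, rfl, rfl, rfl⟩ | ⟨rfl, rfl, rfl, rfl⟩ | ⟨rfl, rfl, rfl, rfl⟩ |
      ⟨rfl, rfl, rfl, rfl⟩ | ⟨rfl, rfl, rfl, rfl⟩ | ⟨rfl, rfl, rfl, rfl⟩ | ⟨rfl, rfl, rfl, rfl⟩) <;>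
    refine ⟨by omega, by omega, fun o v a b ho hv ha hb h1 h2 => ?_⟩ <;> omega

theorem mem_hilbertBasis_iff_even (hn : 4 ≤ n) (h : Even n) (l : Fin n → ℕ) :
    l ∈ hilbertBasis (M n) ↔ l ∈ fiber n 0 1 0 0 ∨ l ∈ fiber n 2 0 0 0 ∨ l ∈ fiber n 0 0 2 0 ∨
      l ∈ fiber n 0 0 0 2 ∨ l ∈ fiber n 1 0 1 1 :=
  (mem_hilbertBasis_iff hn (P := fun o a b => (a + b) % 2 = 0 ∧ (a + o) % 2 = 0)
    (fun _ => mem_M_iff_even h) l).trans (indecomposable_iff_even _ _ _ _)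

theorem mem_hilbertBasis_iff_odd (hn : 4 ≤ n) (h : Odd n) (l : Fin n → ℕ) :
    l ∈ hilbertBasis (M n) ↔ l ∈ fiber n 0 1 0 0 ∨ l ∈ fiber n 2 0 0 0 ∨ l ∈ fiber n 0 0 4 0 ∨
      l ∈ fiber n 0 0 0 4 ∨ l ∈ fiber n 0 0 1 1 ∨ l ∈ fiber n 1 0 2 0 ∨ l ∈ fiber n 1 0 0 2 :=
  (mem_hilbertBasis_iff hn
    (P := fun o a b => (a + b) % 2 = 0 ∧ ((a + b) / 2 + a + o) % 2 = 0)
    (fun _ => mem_M_iff_odd h) l).trans (indecomposable_iff_odd _ _ _ _)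

/-! ### Unit tuples and the monomials of given sums of entries -/

/-- The odd positions `≤ n - 2`. -/
def odds (n : ℕ) : Finset ℕ := (Finset.Icc 1 (n - 2)).filter Odd

/-- The even positions `≤ n - 2`. -/
def evens (n : ℕ) : Finset ℕ := (Finset.Icc 1 (n - 2)).filter (¬ Odd ·)

theorem mem_odds {i : ℕ} : i ∈ odds n ↔ (1 ≤ i ∧ i ≤ n - 2) ∧ Odd i := by simp [odds]

theorem mem_evens {i : ℕ} : i ∈ evens n ↔ (1 ≤ i ∧ i ≤ n - 2) ∧ ¬ Odd i := by
  rw [evens, Finset.mem_filter, Finset.mem_Icc]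

/-- The tuple with entry one at position `i` and zero elsewhere. -/
def unit (n i : ℕ) : Fin n → ℕ := fun k => if (k : ℕ) + 1 = i then 1 else 0

theorem entry_unit (i : ℕ) {j : ℕ} (h1 : 1 ≤ j) (h2 : j ≤ n) :
    entry (unit n i) j = if j = i then 1 else 0 :=
  entry_mk (fun j => if j = i then 1 else 0) h1 h2

theorem entry_nsmul {N : ℕ} (c : ℕ) (l : Fin N → ℕ) (i : ℕ) : entry (c • l) i = c * entry l i := by
  unfold entry; split_ifs <;> simp

theorem oddSum_unit (i : ℕ) : oddSum (unit n i) = if i ∈ odds n then 1 else 0 := by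
  rw [← Finset.sum_ite_eq' (odds n) i (fun _ => 1)]
  refine Finset.sum_congr rfl fun j hj => ?_
  have := mem_odds.1 hj
  exact entry_unit i (by omega) (by omega)

theorem evenSum_unit (i : ℕ) : evenSum (unit n i) = if i ∈ evens n then 1 else 0 := by
  rw [← Finset.sum_ite_eq' (evens n) i (fun _ => 1)]
  refine Finset.sum_congr rfl fun j hj => ?_
  have := mem_evens.1 hj
  exact entry_unit i (by omega) (by omega)

theorem exists_unit_add {l : Fin n → ℕ} {i : ℕ} (h : entry l i ≠ 0) :
    ∃ l', l = unit n i + l' := by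
  refine ⟨fun k => l k - unit n i k, funext fun k => ?_⟩
  simp only [Pi.add_apply, unit]
  split_ifs with hk
  · rw [← hk, entry_succ] at h
    omega
  · omega

theorem unit_add_mem_fiber_of_odd (hn : 4 ≤ n) {o v a b i : ℕ} (hi : i ∈ odds n)
    {l : Fin n → ℕ} : unit n i + l ∈ fiber n (o + 1) v a b ↔ l ∈ fiber n o v a b := by
  have hi' := mem_odds.1 hi
  have he : i ∉ evens n := fun h => (mem_evens.1 h).2 hi'.2
  change _ ∧ _ ∧ _ ∧ _ ↔ _ ∧ _ ∧ _ ∧ _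
  rw [oddSum_add, evenSum_add, entry_add, entry_add, oddSum_unit, evenSum_unit, if_pos hi,
    if_neg he, entry_unit i (by omega) (by omega), entry_unit i (by omega) (by omega),
    if_neg (by omega), if_neg (by omega), zero_add, zero_add, zero_add, add_comm 1,
    Nat.add_right_cancel_iff]

theorem unit_add_mem_fiber_of_even (hn : 4 ≤ n) {o v a b i : ℕ} (hi : i ∈ evens n)
    {l : Fin n → ℕ} : unit n i + l ∈ fiber n o (v + 1) a b ↔ l ∈ fiber n o v a b := by
  have hi' := mem_evens.1 hi
  have he : i ∉ odds n := fun h => hi'.2 (mem_odds.1 h).2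
  change _ ∧ _ ∧ _ ∧ _ ↔ _ ∧ _ ∧ _ ∧ _
  rw [oddSum_add, evenSum_add, entry_add, entry_add, oddSum_unit, evenSum_unit, if_pos hi,
    if_neg he, entry_unit i (by omega) (by omega), entry_unit i (by omega) (by omega),
    if_neg (by omega), if_neg (by omega), zero_add, zero_add, zero_add, add_comm 1,
    Nat.add_right_cancel_iff]

/-- A positive sum has a positive entry, from which one unit can be taken off. Iterating this lists
the fibers; on monomials it takes out a factor `σ_i`. -/
theorem mem_fiber_succ_odd (hn : 4 ≤ n) {o v a b : ℕ} {l : Fin n → ℕ} :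
    l ∈ fiber n (o + 1) v a b ↔ ∃ i ∈ odds n, ∃ l' ∈ fiber n o v a b, l = unit n i + l' := by
  constructor
  · intro hl
    have h1 : ∑ i ∈ odds n, entry l i ≠ 0 := by
      have : ∑ i ∈ odds n, entry l i = o + 1 := hl.1
      omega
    obtain ⟨i, hi, hne⟩ := Finset.exists_ne_zero_of_sum_ne_zero h1
    obtain ⟨l', rfl⟩ := exists_unit_add hne
    exact ⟨i, hi, l', (unit_add_mem_fiber_of_odd hn hi).1 hl, rfl⟩
  · rintro ⟨i, hi, l', hl', rfl⟩
    exact (unit_add_mem_fiber_of_odd hn hi).2 hl'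

theorem mem_fiber_succ_even (hn : 4 ≤ n) {o v a b : ℕ} {l : Fin n → ℕ} :
    l ∈ fiber n o (v + 1) a b ↔ ∃ i ∈ evens n, ∃ l' ∈ fiber n o v a b, l = unit n i + l' := by
  constructor
  · intro hl
    have h1 : ∑ i ∈ evens n, entry l i ≠ 0 := by
      have : ∑ i ∈ evens n, entry l i = v + 1 := hl.2.1
      omega
    obtain ⟨i, hi, hne⟩ := Finset.exists_ne_zero_of_sum_ne_zero h1
    obtain ⟨l', rfl⟩ := exists_unit_add hne
    exact ⟨i, hi, l', (unit_add_mem_fiber_of_even hn hi).1 hl, rfl⟩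
  · rintro ⟨i, hi, l', hl', rfl⟩
    exact (unit_add_mem_fiber_of_even hn hi).2 hl'

/-- The tuple `(0, …, 0, a, b)`. -/
def spinTuple (n a b : ℕ) : Fin n → ℕ := a • unit n (n - 1) + b • unit n n

theorem entry_spinTuple (a b : ℕ) {j : ℕ} (h1 : 1 ≤ j) (h2 : j ≤ n) :
    entry (spinTuple n a b) j = a * (if j = n - 1 then 1 else 0) + b * (if j = n then 1 else 0) := by
  rw [spinTuple, entry_add, entry_nsmul, entry_nsmul, entry_unit _ h1 h2, entry_unit _ h1 h2]

theorem mem_fiber_zero (hn : 4 ≤ n) {a b : ℕ} {l : Fin n → ℕ} :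
    l ∈ fiber n 0 0 a b ↔ l = spinTuple n a b := by
  constructor
  · rintro ⟨h1, h2, h3, h4⟩
    refine ext_entry fun i hi1 hi2 => ?_
    rw [entry_spinTuple a b hi1 hi2]
    by_cases hi : i ≤ n - 2
    · rw [if_neg (by omega), if_neg (by omega)]
      by_cases ho : Odd i
      · exact Finset.sum_eq_zero_iff.1 h1 i (mem_odds.2 ⟨⟨hi1, hi⟩, ho⟩)
      · exact Finset.sum_eq_zero_iff.1 h2 i (mem_evens.2 ⟨⟨hi1, hi⟩, ho⟩)
    · rcases (by omega : i = n - 1 ∨ i = n) with rfl | rfl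
      · rw [if_pos rfl, if_neg (by omega), h3]; omega
      · rw [if_neg (by omega), if_pos rfl, h4]; omega
  · rintro rfl
    refine ⟨Finset.sum_eq_zero fun i hi => ?_, Finset.sum_eq_zero fun i hi => ?_, ?_, ?_⟩
    · have := mem_odds.1 hi
      rw [entry_spinTuple _ _ (by omega) (by omega), if_neg (by omega), if_neg (by omega)]; rfl
    · have := mem_evens.1 hi
      rw [entry_spinTuple _ _ (by omega) (by omega), if_neg (by omega), if_neg (by omega)]; rfl
    · rw [entry_spinTuple _ _ (by omega) (by omega), if_pos rfl, if_neg (by omega)]; omega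
    · rw [entry_spinTuple _ _ (by omega) (by omega), if_pos rfl, if_neg (by omega)]; omega

theorem mono_nsmul (c : ℕ) (l : Fin n → ℕ) : mono (c • l) = mono l ^ c := by
  induction c with
  | zero => simp [mono_zero]
  | succ c ih => rw [succ_nsmul, mono_add, ih, pow_succ]

theorem mono_unit (hn : 4 ≤ n) {i : ℕ} (h1 : 1 ≤ i) (h2 : i ≤ n - 2) :
    mono (unit n i) = sigma n i := by
  rw [mono, entry_unit i (by omega) (by omega), entry_unit i (by omega) (by omega),
    if_neg (by omega), if_neg (by omega), pow_zero, pow_zero, mul_one, mul_one,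
    Finset.prod_eq_single_of_mem i (Finset.mem_Icc.2 ⟨h1, h2⟩)]
  · rw [entry_unit i h1 (by omega), if_pos rfl, pow_one]
  · intro j hj hji
    rw [Finset.mem_Icc] at hj
    rw [entry_unit i hj.1 (by omega), if_neg hji, pow_zero]

theorem mono_spinTuple (hn : 4 ≤ n) (a b : ℕ) :
    mono (spinTuple n a b) = tau n (-1) ^ a * tau n 1 ^ b := by
  have h : ∏ i ∈ Finset.Icc 1 (n - 2), sigma n i ^ entry (spinTuple n a b) i = 1 := by
    refine Finset.prod_eq_one fun i hi => ?_
    rw [Finset.mem_Icc] at hi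
    rw [entry_spinTuple a b hi.1 (by omega), if_neg (by omega), if_neg (by omega)]
    simp
  rw [mono, h, entry_spinTuple a b (by omega) (by omega), entry_spinTuple a b (by omega) le_rfl,
    if_pos rfl, if_neg (by omega), if_neg (by omega), if_pos rfl]
  simp

theorem image_fiber_zero (hn : 4 ≤ n) (a b : ℕ) :
    mono '' fiber n 0 0 a b = {tau n (-1) ^ a * tau n 1 ^ b} := by
  have : fiber n 0 0 a b = {spinTuple n a b} := Set.ext fun l => mem_fiber_zero hn
  rw [this, Set.image_singleton, mono_spinTuple hn]

theorem mem_image_fiber_succ_odd (hn : 4 ≤ n) {o v a b : ℕ} {f : GroupRing n} :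
    f ∈ mono '' fiber n (o + 1) v a b ↔
      ∃ i ∈ odds n, ∃ g ∈ mono '' fiber n o v a b, f = sigma n i * g := by
  constructor
  · rintro ⟨l, hl, rfl⟩
    obtain ⟨i, hi, l', hl', rfl⟩ := (mem_fiber_succ_odd hn).1 hl
    have hi' := mem_odds.1 hi
    exact ⟨i, hi, _, ⟨l', hl', rfl⟩, by rw [mono_add, mono_unit hn hi'.1.1 hi'.1.2]⟩
  · rintro ⟨i, hi, _, ⟨l', hl', rfl⟩, rfl⟩
    have hi' := mem_odds.1 hi
    exact ⟨_, (unit_add_mem_fiber_of_odd hn hi).2 hl', by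
      rw [mono_add, mono_unit hn hi'.1.1 hi'.1.2]⟩

theorem mem_image_fiber_succ_even (hn : 4 ≤ n) {o v a b : ℕ} {f : GroupRing n} :
    f ∈ mono '' fiber n o (v + 1) a b ↔
      ∃ i ∈ evens n, ∃ g ∈ mono '' fiber n o v a b, f = sigma n i * g := by
  constructor
  · rintro ⟨l, hl, rfl⟩
    obtain ⟨i, hi, l', hl', rfl⟩ := (mem_fiber_succ_even hn).1 hl
    have hi' := mem_evens.1 hi
    exact ⟨i, hi, _, ⟨l', hl', rfl⟩, by rw [mono_add, mono_unit hn hi'.1.1 hi'.1.2]⟩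
  · rintro ⟨i, hi, _, ⟨l', hl', rfl⟩, rfl⟩
    have hi' := mem_evens.1 hi
    exact ⟨_, (unit_add_mem_fiber_of_even hn hi).2 hl', by
      rw [mono_add, mono_unit hn hi'.1.1 hi'.1.2]⟩

theorem hilbertBasis_even (hn : 4 ≤ n) (h : Even n) :
    hilbertBasis (M n) = fiber n 0 1 0 0 ∪ (fiber n 2 0 0 0 ∪ (fiber n 0 0 2 0 ∪
      (fiber n 0 0 0 2 ∪ fiber n 1 0 1 1))) :=
  Set.ext (mem_hilbertBasis_iff_even hn h)

theorem hilbertBasis_odd (hn : 4 ≤ n) (h : Odd n) :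
    hilbertBasis (M n) = fiber n 0 1 0 0 ∪ (fiber n 2 0 0 0 ∪ (fiber n 0 0 4 0 ∪
      (fiber n 0 0 0 4 ∪ (fiber n 0 0 1 1 ∪ (fiber n 1 0 2 0 ∪ fiber n 1 0 0 2))))) :=
  Set.ext (mem_hilbertBasis_iff_odd hn h)

theorem mem_image_fiber_even_one (hn : 4 ≤ n) {f : GroupRing n} :
    f ∈ mono '' fiber n 0 1 0 0 ↔ ∃ i ∈ evens n, f = sigma n i := by
  simp [mem_image_fiber_succ_even hn, image_fiber_zero hn]

theorem mem_image_fiber_odd_one (hn : 4 ≤ n) {a b : ℕ} {f : GroupRing n} :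
    f ∈ mono '' fiber n 1 0 a b ↔ ∃ i ∈ odds n, f = sigma n i * (tau n (-1) ^ a * tau n 1 ^ b) := by
  rw [← zero_add 1, mem_image_fiber_succ_odd hn, image_fiber_zero hn]
  simp

theorem mem_image_fiber_odd_two (hn : 4 ≤ n) {f : GroupRing n} :
    f ∈ mono '' fiber n 2 0 0 0 ↔ ∃ i ∈ odds n, ∃ j ∈ odds n, f = sigma n i * sigma n j := by
  rw [show 2 = 1 + 1 from rfl, mem_image_fiber_succ_odd hn]
  simp only [mem_image_fiber_odd_one hn, pow_zero, mul_one]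
  constructor
  · rintro ⟨i, hi, _, ⟨j, hj, rfl⟩, rfl⟩
    exact ⟨i, hi, j, hj, rfl⟩
  · rintro ⟨i, hi, j, hj, rfl⟩
    exact ⟨i, hi, _, ⟨j, hj, rfl⟩, rfl⟩

theorem image_hilbertBasis_even (hn : 4 ≤ n) (h : Even n) :
    mono '' hilbertBasis (M n) = fundEven n := by
  ext f
  simp only [hilbertBasis_even hn h, Set.image_union, Set.mem_union, mem_image_fiber_even_one hn,
    mem_image_fiber_odd_two hn, image_fiber_zero hn, mem_image_fiber_odd_one hn, fundEven,
    Set.mem_singleton_iff, Set.mem_ofPred_eq, pow_zero, one_mul, mul_one, pow_one]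
  constructor
  · rintro (⟨i, hi, rfl⟩ | ⟨i, hi, j, hj, rfl⟩ | rfl | rfl | ⟨i, hi, rfl⟩)
    · obtain ⟨⟨h1, h2⟩, h3⟩ := mem_evens.1 hi
      exact Or.inl (Or.inl ⟨i, h1, by omega, by rw [primEven, if_pos h2, if_neg h3]⟩)
    · obtain ⟨⟨h1, h2⟩, h3⟩ := mem_odds.1 hi
      obtain ⟨⟨k1, k2⟩, k3⟩ := mem_odds.1 hj
      rcases lt_trichotomy i j with hij | rfl | hij
      · exact Or.inr ⟨i, j, h1, hij, k2, h3, k3, rfl⟩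
      · exact Or.inl (Or.inl ⟨i, h1, by omega, by rw [primEven, if_pos h2, if_pos h3, sq]⟩)
      · exact Or.inr ⟨j, i, k1, hij, h2, k3, h3, mul_comm _ _⟩
    · exact Or.inl (Or.inl ⟨n - 1, by omega, by omega, by
        rw [primEven, if_neg (by omega), if_pos rfl]⟩)
    · exact Or.inl (Or.inl ⟨n, by omega, by omega, by
        rw [primEven, if_neg (by omega), if_neg (by omega)]⟩)
    · obtain ⟨⟨h1, h2⟩, h3⟩ := mem_odds.1 hi
      exact Or.inl (Or.inr ⟨i, h1, h2, h3, (mul_assoc _ _ _).symm⟩)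
  · rintro ((⟨i, h1, h2, rfl⟩ | ⟨i, h1, h2, h3, rfl⟩) | ⟨i, j, h1, h2, h3, h4, h5, rfl⟩)
    · unfold primEven
      split_ifs with c1 c2 c3
      · exact Or.inr (Or.inl ⟨i, mem_odds.2 ⟨⟨h1, c1⟩, c2⟩, i, mem_odds.2 ⟨⟨h1, c1⟩, c2⟩, sq _⟩)
      · exact Or.inl ⟨i, mem_evens.2 ⟨⟨h1, c1⟩, c2⟩, rfl⟩
      · exact Or.inr (Or.inr (Or.inl rfl))
      · exact Or.inr (Or.inr (Or.inr (Or.inl rfl)))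
    · exact Or.inr (Or.inr (Or.inr (Or.inr ⟨i, mem_odds.2 ⟨⟨h1, h2⟩, h3⟩, mul_assoc _ _ _⟩)))
    · exact Or.inr (Or.inl ⟨i, mem_odds.2 ⟨⟨h1, by omega⟩, h4⟩, j,
        mem_odds.2 ⟨⟨by omega, h3⟩, h5⟩, rfl⟩)

theorem image_hilbertBasis_odd (hn : 4 ≤ n) (h : Odd n) :
    mono '' hilbertBasis (M n) = fundOdd n := by
  ext f
  simp only [hilbertBasis_odd hn h, Set.image_union, Set.mem_union, mem_image_fiber_even_one hn,
    mem_image_fiber_odd_two hn, image_fiber_zero hn, mem_image_fiber_odd_one hn, fundOdd,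
    Set.mem_singleton_iff, Set.mem_ofPred_eq, pow_zero, one_mul, mul_one, pow_one]
  constructor
  · rintro (⟨i, hi, rfl⟩ | ⟨i, hi, j, hj, rfl⟩ | rfl | rfl | rfl | ⟨i, hi, rfl⟩ | ⟨i, hi, rfl⟩)
    · obtain ⟨⟨h1, h2⟩, h3⟩ := mem_evens.1 hi
      exact Or.inl (Or.inl (Or.inl (Or.inl ⟨i, h1, by omega, by
        rw [primOdd, if_pos h2, if_neg h3]⟩)))
    · obtain ⟨⟨h1, h2⟩, h3⟩ := mem_odds.1 hi
      obtain ⟨⟨k1, k2⟩, k3⟩ := mem_odds.1 hj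
      rcases lt_trichotomy i j with hij | rfl | hij
      · exact Or.inl (Or.inl (Or.inl (Or.inr ⟨i, j, h1, hij, k2, h3, k3, rfl⟩)))
      · exact Or.inl (Or.inl (Or.inl (Or.inl ⟨i, h1, by omega, by
          rw [primOdd, if_pos h2, if_pos h3, sq]⟩)))
      · exact Or.inl (Or.inl (Or.inl (Or.inr ⟨j, i, k1, hij, h2, k3, h3, mul_comm _ _⟩)))
    · exact Or.inl (Or.inl (Or.inl (Or.inl ⟨n - 1, by omega, by omega, by
        rw [primOdd, if_neg (by omega), if_pos rfl]⟩)))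
    · exact Or.inl (Or.inl (Or.inl (Or.inl ⟨n, by omega, by omega, by
        rw [primOdd, if_neg (by omega), if_neg (by omega)]⟩)))
    · exact Or.inl (Or.inl (Or.inr rfl))
    · obtain ⟨⟨h1, h2⟩, h3⟩ := mem_odds.1 hi
      exact Or.inl (Or.inr ⟨i, h1, h2, h3, rfl⟩)
    · obtain ⟨⟨h1, h2⟩, h3⟩ := mem_odds.1 hi
      exact Or.inr ⟨i, h1, h2, h3, rfl⟩
  · rintro ((((⟨i, h1, h2, rfl⟩ | ⟨i, j, h1, h2, h3, h4, h5, rfl⟩) | rfl) | ⟨i, h1, h2, h3, rfl⟩) |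
      ⟨i, h1, h2, h3, rfl⟩)
    · unfold primOdd
      split_ifs with c1 c2 c3
      · exact Or.inr (Or.inl ⟨i, mem_odds.2 ⟨⟨h1, c1⟩, c2⟩, i, mem_odds.2 ⟨⟨h1, c1⟩, c2⟩, sq _⟩)
      · exact Or.inl ⟨i, mem_evens.2 ⟨⟨h1, c1⟩, c2⟩, rfl⟩
      · exact Or.inr (Or.inr (Or.inl rfl))
      · exact Or.inr (Or.inr (Or.inr (Or.inl rfl)))
    · exact Or.inr (Or.inl ⟨i, mem_odds.2 ⟨⟨h1, by omega⟩, h4⟩, j,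
        mem_odds.2 ⟨⟨by omega, h3⟩, h5⟩, rfl⟩)
    · exact Or.inr (Or.inr (Or.inr (Or.inr (Or.inl rfl))))
    · exact Or.inr (Or.inr (Or.inr (Or.inr (Or.inr (Or.inl
        ⟨i, mem_odds.2 ⟨⟨h1, h2⟩, h3⟩, rfl⟩)))))
    · exact Or.inr (Or.inr (Or.inr (Or.inr (Or.inr (Or.inr
        ⟨i, mem_odds.2 ⟨⟨h1, h2⟩, h3⟩, rfl⟩)))))

/-! ### The number of indecomposable elements -/

/-- Every entry is bounded by one of the four prescribed sums. -/
theorem finite_fiber (n o v a b : ℕ) : (fiber n o v a b).Finite := by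
  refine (Set.finite_Iic (fun _ : Fin n => o + v + a + b)).subset fun l hl k => ?_
  obtain ⟨h1, h2, h3, h4⟩ := hl
  change l k ≤ o + v + a + b
  rw [← entry_succ l]
  have hk := k.2
  by_cases hi : (k : ℕ) + 1 ≤ n - 2
  · by_cases ho : Odd ((k : ℕ) + 1)
    · have : entry l (k + 1) ≤ oddSum l := Finset.single_le_sum (f := entry l)
        (fun _ _ => Nat.zero_le _) (mem_odds.2 ⟨⟨by omega, hi⟩, ho⟩)
      omega
    · have : entry l (k + 1) ≤ evenSum l := Finset.single_le_sum (f := entry l)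
        (fun _ _ => Nat.zero_le _) (mem_evens.2 ⟨⟨by omega, hi⟩, ho⟩)
      omega
  · rcases (by omega : (k : ℕ) + 1 = n - 1 ∨ (k : ℕ) + 1 = n) with h | h
    · rw [h, h3]; omega
    · have : entry l (k + 1) = entry l n := congrArg (entry l) h
      omega

theorem card_odds (n : ℕ) : (odds n).card = (n - 1) / 2 := by
  rw [← Finset.card_range ((n - 1) / 2)]
  refine Finset.card_nbij' (fun i => i / 2) (fun k => 2 * k + 1) ?_ ?_ ?_ ?_ <;> intro i hi <;>
    simp only [SetLike.mem_coe, mem_odds, Nat.odd_iff, Finset.mem_range] at hi ⊢ <;> omega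

theorem card_evens (n : ℕ) : (evens n).card = (n - 2) / 2 := by
  rw [← Finset.card_range ((n - 2) / 2)]
  refine Finset.card_nbij' (fun i => i / 2 - 1) (fun k => 2 * k + 2) ?_ ?_ ?_ ?_ <;> intro i hi <;>
    simp only [SetLike.mem_coe, mem_evens, Nat.odd_iff, Finset.mem_range] at hi ⊢ <;> omega

theorem unit_inj {i j : ℕ} (h1 : 1 ≤ i) (h2 : i ≤ n) (h : unit n i = unit n j) : i = j := by
  have := congrArg (fun l => entry l i) h
  simp only [entry_unit _ h1 h2, if_true] at this
  by_contra hne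
  rw [if_neg hne] at this
  omega

theorem ncard_fiber_zero (hn : 4 ≤ n) (a b : ℕ) : (fiber n 0 0 a b).ncard = 1 := by
  have : fiber n 0 0 a b = {spinTuple n a b} := Set.ext fun l => mem_fiber_zero hn
  rw [this, Set.ncard_singleton]

theorem ncard_fiber_odd_one (hn : 4 ≤ n) (a b : ℕ) :
    (fiber n 1 0 a b).ncard = (n - 1) / 2 := by
  have : fiber n 1 0 a b = (fun i => unit n i + spinTuple n a b) '' (odds n : Set ℕ) := by
    ext l
    rw [← zero_add 1, mem_fiber_succ_odd hn]
    simp [mem_fiber_zero hn, eq_comm]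
  rw [this, Set.InjOn.ncard_image, Set.ncard_coe_finset, card_odds]
  intro i hi j _ hij
  have := mem_odds.1 (Finset.mem_coe.1 hi)
  exact unit_inj (by omega) (by omega) (add_right_cancel hij)

theorem ncard_fiber_even_one (hn : 4 ≤ n) : (fiber n 0 1 0 0).ncard = (n - 2) / 2 := by
  have : fiber n 0 1 0 0 = (fun i => unit n i + spinTuple n 0 0) '' (evens n : Set ℕ) := by
    ext l
    rw [← zero_add 1, mem_fiber_succ_even hn]
    simp [mem_fiber_zero hn, eq_comm]
  rw [this, Set.InjOn.ncard_image, Set.ncard_coe_finset, card_evens]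
  intro i hi j _ hij
  have := mem_evens.1 (Finset.mem_coe.1 hi)
  exact unit_inj (by omega) (by omega) (add_right_cancel hij)

/-- The sum of two unit tuples. -/
def unitPair (n : ℕ) : Sym2 ℕ → Fin n → ℕ :=
  Sym2.lift ⟨fun i j => unit n i + unit n j, fun _ _ => add_comm _ _⟩

theorem unitPair_injOn (n : ℕ) : Set.InjOn (unitPair n) ((odds n).sym2 : Set (Sym2 ℕ)) := by
  intro p hp q hq h
  induction p with | _ i j
  induction q with | _ i' j'
  rw [Finset.mem_coe, Finset.mk_mem_sym2_iff] at hp hq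
  have h' : unit n i + unit n j = unit n i' + unit n j' := h
  have hi := mem_odds.1 hp.1
  have hj := mem_odds.1 hp.2
  -- The left side has a positive entry at `i`, so `i` must be `i'` or `j'`.
  have he := congrArg (fun l => entry l i) h'
  simp only [entry_add, entry_unit _ hi.1.1 (show i ≤ n by omega), if_true] at he
  rw [Sym2.eq_iff]
  by_cases h1 : i = i'
  · subst h1
    exact Or.inl ⟨rfl, unit_inj (by omega) (by omega) (add_left_cancel h')⟩
  · by_cases h2 : i = j'
    · subst h2
      rw [add_comm] at h'
      exact Or.inr ⟨rfl, unit_inj (by omega) (by omega) (add_right_cancel h')⟩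
    · rw [if_neg h1, if_neg h2] at he
      omega

/-- These tuples correspond to unordered pairs, with repetition, of the `(n - 1) / 2` odd positions.
-/
theorem two_mul_ncard_fiber_odd_two (hn : 4 ≤ n) :
    2 * (fiber n 2 0 0 0).ncard = ((n - 1) / 2 + 1) * ((n - 1) / 2) := by
  have h0 : spinTuple n 0 0 = 0 := by simp [spinTuple]
  have : fiber n 2 0 0 0 = unitPair n '' ((odds n).sym2 : Set (Sym2 ℕ)) := by
    ext l
    rw [show 2 = 0 + 1 + 1 from rfl, mem_fiber_succ_odd hn]
    constructor
    · rintro ⟨i, hi, l', hl', rfl⟩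
      obtain ⟨j, hj, l'', hl'', rfl⟩ := (mem_fiber_succ_odd hn).1 hl'
      rw [mem_fiber_zero hn, h0] at hl''
      refine ⟨s(i, j), ?_, by rw [hl'', add_zero]; rfl⟩
      rw [Finset.mem_coe, Finset.mk_mem_sym2_iff]
      exact ⟨hi, hj⟩
    · rintro ⟨p, hp, rfl⟩
      induction p with | _ i j
      rw [Finset.mem_coe, Finset.mk_mem_sym2_iff] at hp
      refine ⟨i, hp.1, unit n j, (mem_fiber_succ_odd hn).2 ⟨j, hp.2, 0, ?_, by simp⟩, rfl⟩
      rw [mem_fiber_zero hn, h0]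
  rw [this, (unitPair_injOn n).ncard_image, Set.ncard_coe_finset, Finset.card_sym2,
    card_odds, Nat.choose_two_right, Nat.add_sub_cancel, Nat.mul_div_cancel']
  exact (Nat.even_mul_succ_self _).two_dvd.trans (by rw [mul_comm])

theorem disjoint_fiber {o v a b o' v' a' b' : ℕ} (h : ¬ (o = o' ∧ v = v' ∧ a = a' ∧ b = b')) :
    Disjoint (fiber n o v a b) (fiber n o' v' a' b') := by
  rw [Set.disjoint_left]
  rintro l ⟨h1, h2, h3, h4⟩ ⟨k1, k2, k3, k4⟩
  omega

/-- Since `mono` is injective, exponents can be counted instead, fiber by fiber. -/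
theorem ncard_fundEven (hn : 4 ≤ n) (h : Even n) : 8 * (fundEven n).ncard = n ^ 2 + 6 * n := by
  have fin := finite_fiber n
  have h2 := two_mul_ncard_fiber_odd_two hn
  rw [← image_hilbertBasis_even hn h, Set.ncard_image_of_injective _ (mono_injective (by omega)),
    hilbertBasis_even hn h, Set.ncard_union_eq (by simp [disjoint_fiber]) (fin ..) (by simp [fin]),
    Set.ncard_union_eq (by simp [disjoint_fiber]) (fin ..) (by simp [fin]),
    Set.ncard_union_eq (by simp [disjoint_fiber]) (fin ..) (by simp [fin]),
    Set.ncard_union_eq (by simp [disjoint_fiber]) (fin ..) (fin ..), ncard_fiber_zero hn,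
    ncard_fiber_zero hn, ncard_fiber_odd_one hn, ncard_fiber_even_one hn]
  obtain ⟨r, hr⟩ := h
  obtain ⟨s, rfl⟩ : ∃ s, r = s + 1 := ⟨r - 1, by omega⟩
  rw [show (n - 1) / 2 = s by omega] at h2 ⊢
  rw [show (n - 2) / 2 = s by omega]
  generalize (fiber n 2 0 0 0).ncard = q at h2 ⊢
  rw [hr]
  linarith

theorem ncard_fundOdd (hn : 4 ≤ n) (h : Odd n) :
    8 * (fundOdd n).ncard = n ^ 2 + 12 * n + 3 := by
  have fin := finite_fiber n
  have h2 := two_mul_ncard_fiber_odd_two hn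
  rw [← image_hilbertBasis_odd hn h, Set.ncard_image_of_injective _ (mono_injective (by omega)),
    hilbertBasis_odd hn h, Set.ncard_union_eq (by simp [disjoint_fiber]) (fin ..) (by simp [fin]),
    Set.ncard_union_eq (by simp [disjoint_fiber]) (fin ..) (by simp [fin]),
    Set.ncard_union_eq (by simp [disjoint_fiber]) (fin ..) (by simp [fin]),
    Set.ncard_union_eq (by simp [disjoint_fiber]) (fin ..) (by simp [fin]),
    Set.ncard_union_eq (by simp [disjoint_fiber]) (fin ..) (by simp [fin]),
    Set.ncard_union_eq (by simp [disjoint_fiber]) (fin ..) (fin ..), ncard_fiber_zero hn,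
    ncard_fiber_zero hn, ncard_fiber_zero hn, ncard_fiber_odd_one hn, ncard_fiber_odd_one hn,
    ncard_fiber_even_one hn]
  obtain ⟨r, hr⟩ := h
  obtain ⟨s, rfl⟩ : ∃ s, r = s + 1 := ⟨r - 1, by omega⟩
  rw [show (n - 1) / 2 = s + 1 by omega] at h2 ⊢
  rw [show (n - 2) / 2 = s by omega]
  generalize (fiber n 2 0 0 0).ncard = q at h2 ⊢
  rw [hr]
  linarith

/-! ### Generators of the algebra of invariants -/

/-- Both parts of a proper decomposition have a smaller sum of entries, so the induction is on that
sum. -/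
theorem mono_mem_adjoin {l : Fin n → ℕ} (hl : l ∈ M n) :
    mono l ∈ Algebra.adjoin ℤ (mono '' hilbertBasis (M n)) := by
  induction hd : ∑ k, l k using Nat.strong_induction_on generalizing l with
  | _ d ih =>
  by_cases h0 : l = 0
  · rw [h0, mono_zero]; exact one_mem _
  by_cases hB : l ∈ hilbertBasis (M n)
  · exact Algebra.subset_adjoin ⟨l, hB, rfl⟩
  obtain ⟨a, ha, b, hb, rfl, ha0, hb0⟩ :
      ∃ a ∈ M n, ∃ b ∈ M n, l = a + b ∧ a ≠ 0 ∧ b ≠ 0 := by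
    by_contra! hcon
    refine hB ⟨hl, h0, fun a ha b hb hab => ?_⟩
    by_cases ha0 : a = 0
    · exact Or.inl ha0
    · exact Or.inr (hcon a ha b hb hab ha0)
  have pos : ∀ a : Fin n → ℕ, a ≠ 0 → 0 < ∑ k, a k := by
    intro a ha
    obtain ⟨k, hk⟩ := Function.ne_iff.1 ha
    exact Finset.sum_pos' (fun _ _ => Nat.zero_le _) ⟨k, Finset.mem_univ _, Nat.pos_of_ne_zero hk⟩
  have h1 := pos a ha0
  have h2 := pos b hb0
  simp only [Pi.add_apply, Finset.sum_add_distrib] at hd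
  rw [mono_add]
  exact mul_mem (ih _ (by omega) ha rfl) (ih _ (by omega) hb rfl)

theorem adjoin_image_hilbertBasis (hn : 2 ≤ n) :
    Algebra.adjoin ℤ (mono '' hilbertBasis (M n)) = invariants (rootsD n) := by
  apply le_antisymm
  · rw [Algebra.adjoin_le_iff]
    rintro _ ⟨l, hl, rfl⟩
    exact mono_mem_invariants hn hl.1
  · intro f hf
    have hle : Submodule.span ℤ (mono '' (M n : Set (Fin n → ℕ)))
        ≤ Subalgebra.toSubmodule (Algebra.adjoin ℤ (mono '' hilbertBasis (M n))) := by
      rw [Submodule.span_le]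
      rintro _ ⟨l, hl, rfl⟩
      exact mono_mem_adjoin hl
    exact hle (mem_span_mono hn hf)

/-! ### Primary invariants -/

theorem eq_sum_unit (l : Fin n → ℕ) : l = ∑ j : Fin n, l j • unit n (j + 1) := by
  funext k
  simp [unit, Fin.val_inj]

theorem mono_sum {ι : Type*} (s : Finset ι) (f : ι → Fin n → ℕ) :
    mono (∑ i ∈ s, f i) = ∏ i ∈ s, mono (f i) := by
  classical
  induction s using Finset.induction_on with
  | empty => simp [mono_zero]
  | insert a s ha ih => rw [Finset.sum_insert ha, Finset.prod_insert ha, mono_add, ih]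

theorem mono_mul_eq_prod (c m : Fin n → ℕ) :
    mono (fun j => m j * c j) = ∏ j : Fin n, mono (c j • unit n (j + 1)) ^ m j := by
  conv_lhs => rw [eq_sum_unit (fun j => m j * c j)]
  rw [mono_sum]
  refine Finset.prod_congr rfl fun j _ => ?_
  rw [mul_nsmul, mono_nsmul, mono_nsmul, mono_nsmul, ← pow_mul, ← pow_mul, mul_comm]

/-- As all `c j > 0`, distinct monomials in these elements are distinct `mono l`, which are linearly
independent. -/
theorem algebraicIndependent_mono (hn : 2 ≤ n) {c : Fin n → ℕ} (hc : ∀ j, 0 < c j) :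
    AlgebraicIndependent ℤ fun j : Fin n => mono (c j • unit n (j + 1)) := by
  have hinj : Function.Injective fun (m : Fin n →₀ ℕ) (j : Fin n) => m j * c j := by
    intro m m' h
    ext j
    exact Nat.eq_of_mul_eq_mul_right (hc j) (congrFun h j)
  have hli := (linearIndependent_mono hn).comp _ hinj
  rw [linearIndependent_iff'] at hli
  refine (injective_iff_map_eq_zero _).2 fun F hF => ?_
  rw [MvPolynomial.aeval_def, MvPolynomial.eval₂_eq'] at hF
  ext m
  rw [MvPolynomial.coeff_zero]
  by_cases hm : m ∈ F.support
  · refine hli F.support (fun m => F.coeff m) ?_ m hm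
    rw [← hF]
    refine Finset.sum_congr rfl fun m _ => ?_
    rw [Function.comp_apply, mono_mul_eq_prod, Algebra.smul_def]
  · exact MvPolynomial.notMem_support_iff.1 hm

/-- Since `c j ∣ 4`, the fourth power of `mono l` is the monomial with exponents `l_j * (4 / c_j)`
in the given elements, so every `mono l` with `l ∈ M n` is integral over them. The exponent 4 serves
both parities of `n`. -/
theorem isPrimary_mono (hn : 2 ≤ n) (hfin : (hilbertBasis (M n)).Finite) {c : Fin n → ℕ}
    (hc : ∀ j, 0 < c j) (hM : ∀ j : Fin n, c j • unit n (j + 1) ∈ M n) (hc4 : ∀ j, c j ∣ 4) :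
    IsPrimary (invariants (rootsD n)) fun j : Fin n => mono (c j • unit n (j + 1)) := by
  refine ⟨algebraicIndependent_mono hn hc, fun j => mono_mem_invariants hn (hM j), ?_⟩
  set f := (MvPolynomial.aeval (fun j : Fin n =>
    (⟨mono (c j • unit n (j + 1)), mono_mem_invariants hn (hM j)⟩ : invariants (rootsD n))) :
      MvPolynomial (Fin n) ℤ →ₐ[ℤ] invariants (rootsD n)) with hf
  have hmono : ∀ l : M n, f.toRingHom.IsIntegralElem (monoHom hn (Multiplicative.ofAdd l)) := by
    intro l
    let _ := f.toRingHom.toAlgebra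
    choose d hd using hc4
    have h4 : monoHom hn (Multiplicative.ofAdd l) ^ 4
        = f (∏ j : Fin n, MvPolynomial.X j ^ ((l : Fin n → ℕ) j * d j)) := by
      apply Subtype.ext
      rw [map_prod]
      simp only [map_pow, hf, MvPolynomial.aeval_X]
      push_cast
      rw [← mono_mul_eq_prod c (fun j => (l : Fin n → ℕ) j * d j)]
      change mono (l : Fin n → ℕ) ^ 4 = _
      rw [← mono_nsmul]
      congr 1
      funext j
      rw [Pi.smul_apply, smul_eq_mul, mul_assoc, mul_comm (d j), ← hd j, mul_comm]
    refine IsIntegral.of_pow (R := MvPolynomial (Fin n) ℤ) (n := 4) (by norm_num) ?_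
    rw [h4]
    exact f.toRingHom.isIntegralElem_map
  have hint : f.toRingHom.IsIntegral := by
    intro x
    obtain ⟨g, rfl⟩ := (bijective_lift_monoHom hn).2 x
    induction g using AddMonoidAlgebra.induction_linear with
    | zero => rw [map_zero]; exact f.toRingHom.isIntegralElem_zero
    | add x y hx hy => rw [map_add]; exact hx.add _ hy
    | single l r =>
      rw [AddMonoidAlgebra.lift_single, zsmul_eq_mul]
      refine RingHom.IsIntegralElem.mul _ ?_ (hmono l)
      rw [← map_intCast f.toRingHom r]
      exact f.toRingHom.isIntegralElem_map
  have hft : (algebraMap ℤ (invariants (rootsD n))).FiniteType := by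
    rw [RingHom.finiteType_algebraMap, ← Subalgebra.fg_iff_finiteType, Subalgebra.fg_def]
    exact ⟨_, hfin.image _, adjoin_image_hilbertBasis hn⟩
  -- Finite type over `ℤ` gives finite type over the polynomial ring; together with integrality this
  -- is module-finiteness.
  refine RingHom.IsIntegral.to_finite hint (RingHom.FiniteType.of_comp_finiteType
    (f := (algebraMap ℤ (MvPolynomial (Fin n) ℤ))) ?_)
  exact (show f.toRingHom.comp (algebraMap ℤ (MvPolynomial (Fin n) ℤ)) = algebraMap ℤ _ from
    f.comp_algebraMap) ▸ hft

theorem hilbertBasis_finite_even (hn : 4 ≤ n) (h : Even n) : (hilbertBasis (M n)).Finite := by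
  rw [hilbertBasis_even hn h]
  simp [finite_fiber]

theorem hilbertBasis_finite_odd (hn : 4 ≤ n) (h : Odd n) : (hilbertBasis (M n)).Finite := by
  rw [hilbertBasis_odd hn h]
  simp [finite_fiber]

theorem nsmul_unit_eq_spinTuple (n c : ℕ) :
    c • unit n (n - 1) = spinTuple n c 0 ∧ c • unit n n = spinTuple n 0 c := by
  simp [spinTuple]

theorem isPrimary_even (hn : 4 ≤ n) (h : Even n) :
    IsPrimary (invariants (rootsD n)) fun j : Fin n => primEven n (j + 1) := by
  -- `c j` is the least positive multiple of the unit tuple at position `j + 1` that lies in `M n`.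
  set c : Fin n → ℕ := fun j => if (j : ℕ) + 1 ≤ n - 2 ∧ ¬ Odd ((j : ℕ) + 1) then 1 else 2 with hc
  have hp : (fun j : Fin n => primEven n (j + 1)) = fun j : Fin n => mono (c j • unit n (j + 1)) := by
    funext j
    rw [mono_nsmul, primEven]
    by_cases h1 : (j : ℕ) + 1 ≤ n - 2
    · rw [if_pos h1, mono_unit hn (by omega) h1]
      by_cases h2 : Odd ((j : ℕ) + 1)
      · rw [if_pos h2, show c j = 2 from if_neg fun hh => hh.2 h2]
      · rw [if_neg h2, show c j = 1 from if_pos ⟨h1, h2⟩, pow_one]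
    · have h3 : c j = 2 := if_neg fun hh => h1 hh.1
      rw [if_neg h1, h3, ← mono_nsmul]
      split_ifs with h2
      · rw [h2, (nsmul_unit_eq_spinTuple n 2).1, mono_spinTuple hn, pow_zero, mul_one]
      · rw [show (j : ℕ) + 1 = n by omega, (nsmul_unit_eq_spinTuple n 2).2, mono_spinTuple hn,
          pow_zero, one_mul]
  rw [hp]
  refine isPrimary_mono (by omega) (hilbertBasis_finite_even hn h) (fun j => ?_) (fun j => ?_)
    (fun j => ?_)
  · simp only [hc]; split_ifs <;> norm_num
  · have hs : oddSum (c j • unit n (j + 1)) = c j * oddSum (unit n (j + 1)) := by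
      simp only [oddSum, entry_nsmul, Finset.mul_sum]
    rw [mem_M_iff_even h, entry_nsmul, entry_nsmul, hs, entry_unit _ (by omega) (by omega),
      entry_unit _ (by omega) (by omega), oddSum_unit]
    by_cases h1 : (j : ℕ) + 1 ≤ n - 2 ∧ ¬ Odd ((j : ℕ) + 1)
    · rw [if_neg (by omega), if_neg (by omega), if_neg (fun hh => h1.2 (mem_odds.1 hh).2)]
      simp
    · rw [show c j = 2 from if_neg h1]
      omega
  · simp only [hc]; split_ifs <;> norm_num

theorem isPrimary_odd (hn : 4 ≤ n) (h : Odd n) :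
    IsPrimary (invariants (rootsD n)) fun j : Fin n => primOdd n (j + 1) := by
  -- Again the least multiples in `M n`: for odd `n`, twice a unit tuple at one of the last two
  -- positions still violates the second parity condition, hence 4.
  set c : Fin n → ℕ := fun j => if (j : ℕ) + 1 ≤ n - 2 then
    (if Odd ((j : ℕ) + 1) then 2 else 1) else 4 with hc
  have hp : (fun j : Fin n => primOdd n (j + 1)) = fun j : Fin n => mono (c j • unit n (j + 1)) := by
    funext j
    rw [mono_nsmul, primOdd]
    by_cases h1 : (j : ℕ) + 1 ≤ n - 2
    · rw [if_pos h1, mono_unit hn (by omega) h1]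
      by_cases h2 : Odd ((j : ℕ) + 1)
      · rw [if_pos h2, show c j = 2 by simp only [hc, if_pos h1, if_pos h2]]
      · rw [if_neg h2, show c j = 1 by simp only [hc, if_pos h1, if_neg h2], pow_one]
    · have h3 : c j = 4 := if_neg h1
      rw [if_neg h1, h3, ← mono_nsmul]
      split_ifs with h2
      · rw [h2, (nsmul_unit_eq_spinTuple n 4).1, mono_spinTuple hn, pow_zero, mul_one]
      · rw [show (j : ℕ) + 1 = n by omega, (nsmul_unit_eq_spinTuple n 4).2, mono_spinTuple hn,
          pow_zero, one_mul]
  rw [hp]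
  refine isPrimary_mono (by omega) (hilbertBasis_finite_odd hn h) (fun j => ?_) (fun j => ?_)
    (fun j => ?_)
  · simp only [hc]; split_ifs <;> norm_num
  · have hs : oddSum (c j • unit n (j + 1)) = c j * oddSum (unit n (j + 1)) := by
      simp only [oddSum, entry_nsmul, Finset.mul_sum]
    rw [mem_M_iff_odd h, entry_nsmul, entry_nsmul, hs, entry_unit _ (by omega) (by omega),
      entry_unit _ (by omega) (by omega), oddSum_unit]
    by_cases h1 : (j : ℕ) + 1 ≤ n - 2
    · rw [if_neg (by omega), if_neg (by omega)]
      by_cases h2 : Odd ((j : ℕ) + 1)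
      · rw [show c j = 2 by simp only [hc, if_pos h1, if_pos h2]]
        omega
      · rw [if_neg (fun hh => h2 (mem_odds.1 hh).2)]
        simp
    · rw [show c j = 4 from if_neg h1, if_neg (fun hh => h1 (mem_odds.1 hh).1.2)]
      split_ifs <;> omega
  · simp only [hc]; split_ifs <;> norm_num

end RootInv

open RootInv in
theorem theorem6p1 (n : ℕ) (hn : 4 ≤ n) :
    -- `τ_±` are the orbit sums of the half-spin weights
    (tau n 1 = orbitSum (rootsD n) (spinPlus n) ∧ tau n (-1) = orbitSum (rootsD n) (spinMinus n)) ∧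
    -- the isomorphism `ℤ[M_n] ≅ ℤ[D_n]^W`
    (∃ Ω : AddMonoidAlgebra ℤ (M n) ≃ₐ[ℤ] invariants (rootsD n),
      ∀ l : M n, (Ω (AddMonoidAlgebra.single l 1) : GroupRing n) = mono (l : Fin n → ℕ)) ∧
    -- the decomposition of `M_n`
    Nonempty (M n ≃+ (Fin ((n - 2) / 2) → ℕ) × W n) ∧
    -- the Hilbert basis, fundamental invariants and primary invariants for `n` even
    (Even n →
      mono '' hilbertBasis (M n) = fundEven n ∧
      8 * (fundEven n).ncard = n ^ 2 + 6 * n ∧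
      Algebra.adjoin ℤ (fundEven n) = invariants (rootsD n) ∧
      IsPrimary (invariants (rootsD n)) (fun j : Fin n => primEven n (j + 1))) ∧
    -- the same for `n` odd
    (Odd n →
      mono '' hilbertBasis (M n) = fundOdd n ∧
      8 * (fundOdd n).ncard = n ^ 2 + 12 * n + 3 ∧
      Algebra.adjoin ℤ (fundOdd n) = invariants (rootsD n) ∧
      IsPrimary (invariants (rootsD n)) (fun j : Fin n => primOdd n (j + 1))) := by
  refine ⟨⟨?_, ?_⟩, ?_, M_decomposition hn, fun h => ?_, fun h => ?_⟩
  · rw [spinPlus_eq, orbitSum_half]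
    simp
  · rw [spinMinus_eq, orbitSum_half, prod_minusSigns (by omega)]
  · refine ⟨AlgEquiv.ofBijective _ (bijective_lift_monoHom (by omega)), fun l => ?_⟩
    rw [AlgEquiv.ofBijective_apply, AddMonoidAlgebra.lift_single, one_smul]
    rfl
  · exact ⟨image_hilbertBasis_even hn h, ncard_fundEven hn h,
      image_hilbertBasis_even hn h ▸ adjoin_image_hilbertBasis (by omega), isPrimary_even hn h⟩
  · exact ⟨image_hilbertBasis_odd hn h, ncard_fundOdd hn h,
      image_hilbertBasis_odd hn h ▸ adjoin_image_hilbertBasis (by omega), isPrimary_odd hn h⟩
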